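/- \textbf{Setting.} A set system consists of $S_1,\dots,S_m\subseteq\mathcal U$. For a list $P$ of sets let $\mathrm{new}_P(S)=|S\setminus\bigcup_{S'\in P}S'|$; a greedy choice after $P$ is a set $G$ of the system maximizing $\mathrm{new}_P$. An ordering $s_1,\dots,s_m$ of the system is \emph{$(\alpha,\beta)$-prefix optimal} if there are reals $\alpha_1,\dots,\alpha_m$ with $\frac1i\sum_{j\le i}\alpha_j\ge\alpha$ and $\mathrm{new}_{(s_1,\dots,s_{i-1})}(s_i)\ge\alpha_i\cdot\mathrm{new}_{(s_1,\dots,s_{i-1})}(G)-\beta$ for every $i$ and every greedy choice $G$ after $s_1,\dots,s_{i-1}$. $\mathrm{Lap}(b)$ has density $e^{-|x|/b}/(2b)$; all random draws below are fresh and independent. \textbf{DP-MaNIS} (size parameter $n$, privacy parameter $\epsilon'$, sets $A$, elements $B$; constants $C_1,C_2$). Write $N(a)$ for the elements of $a$, and put $\delta=\epsilon'/(C_1\log n)$, $A^{(0)}=A$, $B^{(0)}=B$, $\tilde D(a)=|N(a)\cap B|+\mathrm{Lap}(2/\delta)$. For $r=0,\dots,\lceil C_2\log n\rceil$: draw $x_a$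 uniformly from $[0,1]$; for $b\in B^{(r)}$ let $\varphi(b)$ be the set $a\in A^{(r)}$ containing $b$ with largest $x_a$; let \[J^{(r)}=\{a\in A^{(r)}:|\{b\in B^{(r)}:\varphi(b)=a\}|+\mathrm{Lap}(1/\delta)\ge(1-4\eta)\tilde D(a)\},\] $B^{(r+1)}=B^{(r)}\setminus\bigcup_{a\in J^{(r)}}N(a)$, and \[A^{(r+1)}=\Bigl\{a\in A^{(r)}\setminus J^{(r)}:|N(a)\cap B^{(r+1)}|+\mathrm{Lap}(1/\delta)\ge(1-\eta)\tilde D(a)+\tfrac{6\log n}{(1-3\eta)\delta}\Bigr\}.\] Output $J^{(0)},J^{(1)},\dots$ concatenated, each sorted by decreasing $x_a$. \textbf{Algorithm 2} (size parameter $n$, privacy parameter $\epsilon$; constants $C_1,C_2,K$). Let $T=\lceil\log_{1/(1-\eta)}n\rceil$, $\epsilon_0=\epsilon/(2T)$, $\mathcal U_T=\mathcal U$, and let $\mathcal S_T$ be the whole system. For $t=T,\dots,1$: let $\mathcal A_t$ be the sets $S\in\mathcal S_t$ for which \[\frac1{(1-\eta)^{t-1}}-\frac{K\log^2n}{\epsilon_0}\le|S\cap\mathcal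 U_t|+\mathrm{Lap}(1/\epsilon_0)\le\frac1{(1-\eta)^t}+\frac{K\log^2n}{\epsilon_0};\] let $J_t$ be the output of DP-MaNIS on $(\mathcal A_t,\mathcal U_t)$ with privacy parameter $\epsilon_0$; let $\mathcal U_{t-1}=\mathcal U_t\setminus\bigcup_{S\in J_t}S$ and $\mathcal S_{t-1}=\mathcal S_t\setminus J_t$. Output the concatenation of $J_T,\dots,J_1,\mathcal S_0$ (with $\mathcal S_0$ in index order). \textbf{Theorem.} Let $0<\eta<1/3$ and $k\in\mathbb N$. For every sufficiently large $C_2$ (depending on $\eta,k$), every $C_1>0$ and every sufficiently large $K$ (depending on $\eta,k,C_1,C_2$), there are constants $c,C>0$ and $d\in\mathbb N$, depending only on $\eta,k,C_1,C_2,K$, such that for all $n\ge2$, all set systems with $|\mathcal U|\le n$ and $m\le n^k$, and all $\epsilon>0$, with probability at least $1-C\log^d(n)/n^2$ the output of Algorithm 2 is an ordering of the set system that is $(1-5\eta,\;c\log^2n/\epsilon_0)$-prefix optimal; in fact, each output set covers at least $(1-5\eta)$ times the new coverage of the greedy choice, minus $c\log^2n/\epsilon_0$. -/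

import Mathlib

open MeasureTheory

namespace DPCover

/-- The Laplace distribution `Lap(b)` on `ℝ`, with density `exp (-|x| / b) / (2 b)`. -/
noncomputable def laplace (b : ℝ) : Measure ℝ :=
  volume.withDensity fun x => ENNReal.ofReal (Real.exp (-|x| / b) / (2 * b))

/-- The uniform distribution on `[0, 1]`. -/
noncomputable def uniform01 : Measure ℝ := volume.restrict (Set.Icc 0 1)

/-! ### The private nearly independent set procedure

A set system with `m` sets over a universe of `N` elements is a map
`S : Fin m → Finset (Fin N)`.  Randomized algorithms are deterministic functions of the tape of
all their random draws, and the tape is distributed according to a product measure. -/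

/-- The draws of one round: for every set index `a`, the priority `x_a`, the noise in the
selection test and the noise in the survival test. -/
abbrev RoundTape (m : ℕ) : Type := Fin m → ℝ × ℝ × ℝ

/-- The draws of a call with `R` rounds: the noise of the degree estimates, then the rounds. -/
abbrev ManisTape (m R : ℕ) : Type := (Fin m → ℝ) × (Fin R → RoundTape m)

/-- The loop state: remaining sets `A`, remaining elements `B`, and the sets chosen so far. -/
structure ManisState (m N : ℕ) where
  A : Finset (Fin m)
  B : Finset (Fin N)
  out : List (Fin m)

open Classical in
/-- The elements `b ∈ B` that pick `a`: among the sets of `A` containing `b`, the set `a` has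
the largest priority (priorities are almost surely distinct). -/
noncomputable def picks {m N : ℕ} (S : Fin m → Finset (Fin N)) (A : Finset (Fin m))
    (B : Finset (Fin N)) (x : Fin m → ℝ) (a : Fin m) : Finset (Fin N) :=
  B.filter fun b => b ∈ S a ∧ ∀ a' ∈ A, b ∈ S a' → x a' ≤ x a

open Classical in
/-- The elements of `J` listed in decreasing order of priority. -/
noncomputable def sortByPriority {m : ℕ} (x : Fin m → ℝ) (J : Finset (Fin m)) : List (Fin m) :=
  ((List.finRange m).filter fun a => a ∈ J).insertionSort fun a a' => x a' ≤ x a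

open Classical in
/-- One round.  `deg` are the noisy degree estimates made at the start of the call, and `θ` is
the additive offset of the survival test. -/
noncomputable def manisStep {m N : ℕ} (S : Fin m → Finset (Fin N)) (η θ : ℝ) (deg : Fin m → ℝ)
    (s : ManisState m N) (ω : RoundTape m) : ManisState m N :=
  let x : Fin m → ℝ := fun a => (ω a).1
  let J : Finset (Fin m) := s.A.filter fun a =>
    ((picks S s.A s.B x a).card : ℝ) + (ω a).2.1 ≥ (1 - 4 * η) * deg a
  let B' : Finset (Fin N) := s.B \ J.biUnion S
  let A' : Finset (Fin m) := (s.A \ J).filter fun a =>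
    (((S a ∩ s.B) ∩ B').card : ℝ) + (ω a).2.2 ≥ (1 - η) * deg a + θ
  { A := A', B := B', out := s.out ++ sortByPriority x J }

/-- The per-query privacy parameter `ε / (C₁ log n)` inside a call with privacy parameter `ε`. -/
noncomputable def manisEps (n : ℕ) (C₁ ε : ℝ) : ℝ := ε / (C₁ * Real.log n)

/-- The number of rounds `t = 0, …, ⌈C₂ log n⌉`. -/
noncomputable def manisRounds (n : ℕ) (C₂ : ℝ) : ℕ := ⌈C₂ * Real.log n⌉₊ + 1

/-- The private nearly independent set procedure, run with privacy parameter `ε` on the universe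
`B` and the sets `S a ∩ B`, `a ∈ A`; the result is the ordered list of chosen sets. -/
noncomputable def manis {m N R : ℕ} (S : Fin m → Finset (Fin N)) (n : ℕ) (η C₁ ε : ℝ)
    (A : Finset (Fin m)) (B : Finset (Fin N)) (ω : ManisTape m R) : List (Fin m) :=
  let deg : Fin m → ℝ := fun a => ((S a ∩ B).card : ℝ) + ω.1 a
  let θ : ℝ := 6 * Real.log n / ((1 - 3 * η) * manisEps n C₁ ε)
  ((List.ofFn ω.2).foldl (manisStep S η θ deg) { A := A, B := B, out := [] }).out

/-- The joint law of the (independent) draws of a call: degree noise `Lap(2/ε')`, priorities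
uniform in `[0, 1]`, all the other noise `Lap(1/ε')`, where `ε'` is the per-query parameter. -/
noncomputable def manisLaw (m R n : ℕ) (C₁ ε : ℝ) : Measure (ManisTape m R) :=
  (Measure.pi fun _ : Fin m => laplace (2 / manisEps n C₁ ε)).prod
    (Measure.pi fun _ : Fin R => Measure.pi fun _ : Fin m =>
      uniform01.prod ((laplace (1 / manisEps n C₁ ε)).prod (laplace (1 / manisEps n C₁ ε))))

/-! ### The private coverage algorithm -/

/-- The number of phases, `log_{1/(1-η)} n` rounded up. -/
noncomputable def phases (n : ℕ) (η : ℝ) : ℕ := ⌈Real.logb (1 / (1 - η)) n⌉₊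

/-- `ε₀ = ε / (2 T)`, where `T` is the number of phases. -/
noncomputable def eps0 (n : ℕ) (η ε : ℝ) : ℝ := ε / (2 * (phases n η : ℝ))

/-- The draws of the algorithm: in each phase, one noise value per set for the bucket test, and
the draws of the call to the nearly independent set procedure. -/
abbrev CoverTape (m T R : ℕ) : Type := Fin T → (Fin m → ℝ) × ManisTape m R

/-- The loop state: uncovered elements `U`, remaining sets, and the sets output so far. -/
structure CoverState (m N : ℕ) where
  U : Finset (Fin N)
  rem : Finset (Fin m)
  out : List (Fin m)

open Classical in
/-- The phase with index `t`, `1 ≤ t ≤ T`. -/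
noncomputable def coverStep {m N R : ℕ} (S : Fin m → Finset (Fin N)) (n : ℕ)
    (η C₁ K ε : ℝ) (t : ℕ) (ω : (Fin m → ℝ) × ManisTape m R) (s : CoverState m N) :
    CoverState m N :=
  let ε₀ : ℝ := eps0 n η ε
  let bucket : Finset (Fin m) := s.rem.filter fun a =>
    1 / (1 - η) ^ (t - 1) - K * Real.log n ^ 2 / ε₀ ≤ ((S a ∩ s.U).card : ℝ) + ω.1 a ∧
    ((S a ∩ s.U).card : ℝ) + ω.1 a ≤ 1 / (1 - η) ^ t + K * Real.log n ^ 2 / ε₀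
  let J : List (Fin m) := manis S n η C₁ ε₀ bucket s.U ω.2
  { U := s.U \ J.toFinset.biUnion S, rem := s.rem \ J.toFinset, out := s.out ++ J }

open Classical in
/-- The output of the algorithm: the phases `t = T, …, 1` are run in this order, and the sets
that were never chosen are appended at the end. -/
noncomputable def coverOutput {m N T R : ℕ} (S : Fin m → Finset (Fin N)) (n : ℕ)
    (η C₁ K ε : ℝ) (ω : CoverTape m T R) : List (Fin m) :=
  let s : CoverState m N := (List.finRange T).reverse.foldl
    (fun s i => coverStep S n η C₁ K ε (i.val + 1) (ω i) s)
    { U := Finset.univ, rem := Finset.univ, out := [] }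
  s.out ++ (List.finRange m).filter fun a => a ∈ s.rem

/-- The joint law of the (independent) draws of the algorithm: the bucket noise is `Lap(1/ε₀)`,
and the nearly independent set procedure is called with privacy parameter `ε₀`. -/
noncomputable def coverLaw (m n : ℕ) (η C₁ C₂ ε : ℝ) :
    Measure (CoverTape m (phases n η) (manisRounds n C₂)) :=
  Measure.pi fun _ : Fin (phases n η) =>
    (Measure.pi fun _ : Fin m => laplace (1 / eps0 n η ε)).prod
      (manisLaw m (manisRounds n C₂) n C₁ (eps0 n η ε))

/-! ### Prefix optimality -/

/-- The number of elements of the set `a` not covered by the sets listed in `P`. -/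
def newCoverage {m N : ℕ} (S : Fin m → Finset (Fin N)) (P : List (Fin m)) (a : Fin m) : ℕ :=
  (S a \ P.toFinset.biUnion S).card

/-- `g` is a possible greedy choice after the sets listed in `P`. -/
def IsGreedyChoice {m N : ℕ} (S : Fin m → Finset (Fin N)) (P : List (Fin m)) (g : Fin m) :
    Prop :=
  ∀ a, newCoverage S P a ≤ newCoverage S P g

/-- The list `l` of sets is `(α, β)`-prefix optimal: for some real numbers `c 0, c 1, …` all of
whose running averages are at least `α`, each entry `l[i]` covers at least `c i` times as many
new elements as the greedy choice after `l[0], …, l[i-1]`, minus `β`. -/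
def IsPrefixOptimal {m N : ℕ} (S : Fin m → Finset (Fin N)) (α β : ℝ) (l : List (Fin m)) : Prop :=
  ∃ c : ℕ → ℝ, ∀ (i : ℕ) (hi : i < l.length),
    α ≤ (∑ j ∈ Finset.range (i + 1), c j) / ((i : ℝ) + 1) ∧
    ∀ g, IsGreedyChoice S (l.take i) g →
      (newCoverage S (l.take i) l[i] : ℝ) ≥ c i * (newCoverage S (l.take i) g : ℝ) - β

end DPCover

/-!
Call a pair `(a, b)` an edge when `a` is a remaining set containing the remaining element `b`.
In one round each edge is lost with constant probability on average. If `a` is so depleted that it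
fails the survival test without noise, then it survives with probability at most `1/2`. Otherwise
at least an `η` fraction of its elements `b` are exceeded in degree by at most an `η` fraction of
its elements. With probability of order `η / deg b`, such an `a` exceeds the priority
`1 - η / (2 deg b)` and is alone among the sets containing `b` in doing so; conditionally on this,
by Markov's inequality, few of its elements of degree at most `deg b` are contested by another
set of such priority, so that almost all of `a` picks `a`, which is selected and removes `b`. For
fixed `b` these events are disjoint over `a`, so they can be charged to the `deg b` edges at `b`.
Hence after `C₂ log n` rounds no edge is left, except with probability `n ^ (-3)` per call.

The rest is deterministic, once all noise is `O(log² n / ε₀)`, the priorities are distinct and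
every call exhausts its edges. Up to noise, a chosen set newly covers at least `1 - 4η` times its
coverage at the start of the call, while a set which is not chosen drops below `1 - η` times its
coverage. By induction over the phases every remaining set covers at most
`(1 - η) ^ (-t) + O(log² n / ε₀)` new elements at the start of phase `t`, and this bounds the
greedy choice against which the chosen sets are compared. For `1/5 ≤ η` the factor `1 - 5η` is
not positive and nothing is to be shown.
-/

namespace DPCover

/-! ### Product measures and counting events -/

section Product

variable {ι α σ : Type*} [Fintype ι] [MeasurableSpace α] [MeasurableSpace σ]

lemma lintegral_pi_eq_lintegral_lintegral [DecidableEq ι] (μ : ι → Measure α)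
    [∀ i, IsProbabilityMeasure (μ i)] (i : ι) {f : (ι → α) → σ} (hf : Measurable f)
    (hfi : ∀ ω y, f (Function.update ω i y) = f ω) {g : σ × α → ENNReal} (hg : Measurable g) :
    ∫⁻ ω, g (f ω, ω i) ∂Measure.pi μ = ∫⁻ ω, ∫⁻ y, g (f ω, y) ∂μ i ∂Measure.pi μ := by
  refine lintegral_eq_of_lmarginal_eq {i} (hg.comp (hf.prodMk (measurable_pi_apply i)))
    (hg.lintegral_prod_right'.comp hf) ?_
  simp only [lmarginal_singleton, hfi, Function.update_self, lintegral_const, measure_univ,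
    mul_one]

lemma measure_prod_le_of_forall_measure_le (μ : Measure σ) [IsProbabilityMeasure μ]
    (ν : Measure α) [SFinite ν] {E : Set (σ × α)} (hE : MeasurableSet E) {p : ENNReal}
    (hp : ∀ s, ν {y | (s, y) ∈ E} ≤ p) : μ.prod ν E ≤ p :=
  calc μ.prod ν E = ∫⁻ s, ν {y | (s, y) ∈ E} ∂μ := Measure.prod_apply hE
    _ ≤ ∫⁻ _, p ∂μ := lintegral_mono hp
    _ = p := by simp

lemma measure_pi_le_of_forall_measure_le [DecidableEq ι] (μ : ι → Measure α)
    [∀ i, IsProbabilityMeasure (μ i)] (i : ι) {f : (ι → α) → σ} (hf : Measurable f)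
    (hfi : ∀ ω y, f (Function.update ω i y) = f ω) {E : Set (σ × α)} (hE : MeasurableSet E)
    {p : ENNReal} (hp : ∀ s, μ i {y | (s, y) ∈ E} ≤ p) :
    Measure.pi μ {ω | (f ω, ω i) ∈ E} ≤ p :=
  calc Measure.pi μ {ω | (f ω, ω i) ∈ E}
      = ∫⁻ ω, E.indicator 1 (f ω, ω i) ∂Measure.pi μ :=
        (lintegral_indicator_one (hf.prodMk (measurable_pi_apply i) hE)).symm
    _ = ∫⁻ ω, ∫⁻ y, E.indicator 1 (f ω, y) ∂μ i ∂Measure.pi μ :=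
        lintegral_pi_eq_lintegral_lintegral μ i hf hfi (measurable_one.indicator hE)
    _ = ∫⁻ ω, μ i {y | (f ω, y) ∈ E} ∂Measure.pi μ := by
        congr! 2 with ω
        exact lintegral_indicator_one (measurable_prodMk_left hE)
    _ ≤ ∫⁻ _, p ∂Measure.pi μ := lintegral_mono fun ω => hp (f ω)
    _ = p := by simp

lemma measure_pi_setOf_exists_le (μ : ι → Measure α) [∀ i, IsProbabilityMeasure (μ i)]
    {E : ι → Set α} {p : ENNReal} (hE : ∀ i, μ i (E i) ≤ p) :
    Measure.pi μ {ω | ∃ i, ω i ∈ E i} ≤ Fintype.card ι * p := by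
  rw [Set.ofPred_exists]
  calc Measure.pi μ (⋃ i, {ω | ω i ∈ E i})
      ≤ ∑ i, Measure.pi μ (Function.eval i ⁻¹' E i) := measure_iUnion_fintype_le _ _
    _ ≤ ∑ _i : ι, p := Finset.sum_le_sum fun i _ =>
        ((measurePreserving_eval μ i).measure_preimage_le (E i)).trans (hE i)
    _ = Fintype.card ι * p := by simp

lemma measure_prod_setOf_or_le (μ : Measure σ) [IsProbabilityMeasure μ] (ν : Measure α)
    [IsProbabilityMeasure ν] (E : Set σ) (F : Set α) :
    μ.prod ν {p | p.1 ∈ E ∨ p.2 ∈ F} ≤ μ E + ν F :=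
  (measure_union_le (Prod.fst ⁻¹' E) (Prod.snd ⁻¹' F)).trans
    (add_le_add (measurePreserving_fst.measure_preimage_le E)
      (measurePreserving_snd.measure_preimage_le F))

end Product

section Counting

variable {α κ : Type*} (I : Finset κ) {E : κ → Set α} [∀ ω, DecidablePred fun i => ω ∈ E i]

lemma card_filter_mem_eq_sum_indicator (ω : α) :
    ((I.filter fun i => ω ∈ E i).card : ENNReal) = ∑ i ∈ I, (E i).indicator 1 ω := by
  simp only [Set.indicator_apply, Pi.one_apply, Finset.sum_boole]

variable [MeasurableSpace α]

lemma lintegral_card_filter_mem (μ : Measure α) (hE : ∀ i ∈ I, MeasurableSet (E i)) :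
    ∫⁻ ω, ((I.filter fun i => ω ∈ E i).card : ENNReal) ∂μ = ∑ i ∈ I, μ (E i) := by
  simp only [card_filter_mem_eq_sum_indicator]
  rw [lintegral_finsetSum _ fun i hi => measurable_one.indicator (hE i hi)]
  exact Finset.sum_congr rfl fun i hi => lintegral_indicator_one (hE i hi)

lemma mul_measureReal_le_card_filter_mem_le (μ : Measure α) [IsFiniteMeasure μ]
    (hE : ∀ i ∈ I, MeasurableSet (E i)) {t : ℝ} (ht : 0 ≤ t) :
    t * μ.real {ω | t ≤ (I.filter fun i => ω ∈ E i).card} ≤ ∑ i ∈ I, μ.real (E i) := by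
  have hmeas : Measurable fun ω => ((I.filter fun i => ω ∈ E i).card : ENNReal) := by
    simp only [card_filter_mem_eq_sum_indicator]
    exact Finset.measurable_sum _ fun i hi => measurable_one.indicator (hE i hi)
  have hmarkov := mul_meas_ge_le_lintegral (μ := μ) hmeas (ENNReal.ofReal t)
  simp only [lintegral_card_filter_mem I μ hE, ENNReal.ofReal_le_natCast] at hmarkov
  simpa [measureReal_def, ENNReal.toReal_sum, ENNReal.toReal_ofReal ht]
    using ENNReal.toReal_mono (by simp) hmarkov

end Counting

/-! ### The Laplace and uniform distributions -/

lemma laplace_Ioi {b t : ℝ} (hb : 0 < b) (ht : 0 ≤ t) :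
    laplace b (Set.Ioi t) = ENNReal.ofReal (Real.exp (-t / b) / 2) := by
  have hneg : -1 / b < 0 := div_neg_of_neg_of_pos (by norm_num) hb
  have hdensity : ∀ x ∈ Set.Ioi t, ENNReal.ofReal (Real.exp (-|x| / b) / (2 * b)) =
      ENNReal.ofReal (Real.exp (-1 / b * x) / (2 * b)) := fun x hx => by
    rw [abs_of_nonneg (ht.trans (le_of_lt hx))]
    ring_nf
  rw [laplace, withDensity_apply _ measurableSet_Ioi,
    setLIntegral_congr_fun measurableSet_Ioi hdensity, ← ofReal_integral_eq_lintegral_ofReal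
      ((integrableOn_exp_mul_Ioi hneg t).div_const _) (ae_of_all _ fun x => by positivity),
    integral_div, integral_exp_mul_Ioi hneg t, div_mul_eq_mul_div, neg_one_mul]
  congr 1
  field_simp

lemma laplace_Iio_neg {b t : ℝ} (hb : 0 < b) (ht : 0 ≤ t) :
    laplace b (Set.Iio (-t)) = ENNReal.ofReal (Real.exp (-t / b) / 2) := by
  rw [← laplace_Ioi hb ht, laplace, withDensity_apply _ measurableSet_Ioi,
    withDensity_apply _ measurableSet_Iio, ← lintegral_indicator measurableSet_Ioi,
    ← lintegral_indicator measurableSet_Iio, ← lintegral_neg_eq_self]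
  simp only [Set.indicator_apply, Set.mem_Iio, Set.mem_Ioi, neg_lt_neg_iff, abs_neg]

lemma isProbabilityMeasure_laplace {b : ℝ} (hb : 0 < b) : IsProbabilityMeasure (laplace b) := by
  have hzero : laplace b {0} = 0 := withDensity_absolutelyContinuous _ _ (by simp)
  have huniv : (Set.univ : Set ℝ) = Set.Iio (-0) ∪ ({0} ∪ Set.Ioi 0) := by
    rw [neg_zero, Set.singleton_union, Set.Ioi_insert, Set.Iio_union_Ici]
  constructor
  rw [huniv, measure_union (by simp) (by measurability), measure_union (by simp) measurableSet_Ioi,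
    hzero, laplace_Ioi hb le_rfl, laplace_Iio_neg hb le_rfl, zero_add,
    ← ENNReal.ofReal_add (by positivity) (by positivity)]
  norm_num

lemma laplace_setOf_lt_abs_le {b t : ℝ} (hb : 0 < b) (ht : 0 ≤ t) :
    laplace b {x | t < |x|} ≤ ENNReal.ofReal (Real.exp (-t / b)) :=
  calc laplace b {x | t < |x|} = laplace b (Set.Iio (-t) ∪ Set.Ioi t) := by
        congr 1; ext x; simp [lt_abs, lt_neg, or_comm]
    _ ≤ laplace b (Set.Iio (-t)) + laplace b (Set.Ioi t) := measure_union_le _ _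
    _ = ENNReal.ofReal (Real.exp (-t / b)) := by
        rw [laplace_Ioi hb ht, laplace_Iio_neg hb ht,
          ← ENNReal.ofReal_add (by positivity) (by positivity), add_halves]

lemma half_le_laplace_Ici {b : ℝ} (hb : 0 < b) : 1 / 2 ≤ (laplace b).real (Set.Ici 0) := by
  have := isProbabilityMeasure_laplace hb
  calc 1 / 2 = (laplace b).real (Set.Ioi 0) := by simp [measureReal_def, laplace_Ioi hb le_rfl]
    _ ≤ (laplace b).real (Set.Ici 0) := measureReal_mono Set.Ioi_subset_Ici_self

lemma half_le_laplace_Iic {b : ℝ} (hb : 0 < b) : 1 / 2 ≤ (laplace b).real (Set.Iic 0) := by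
  have := isProbabilityMeasure_laplace hb
  calc 1 / 2 = (laplace b).real (Set.Iio (-0)) := by
        simp only [measureReal_def, laplace_Iio_neg hb le_rfl]; simp
    _ ≤ (laplace b).real (Set.Iic 0) := measureReal_mono (by simp)

instance : IsProbabilityMeasure uniform01 := ⟨by simp [uniform01]⟩

instance : NullSingletonClass uniform01 :=
  inferInstanceAs (NullSingletonClass (volume.restrict (Set.Icc (0 : ℝ) 1)))

lemma uniform01_Ici {τ : ℝ} (h0 : 0 ≤ τ) (h1 : τ ≤ 1) : uniform01.real (Set.Ici τ) = 1 - τ := by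
  have hinter : Set.Ici τ ∩ Set.Icc 0 1 = Set.Icc τ 1 := by
    rw [← Set.Ici_inter_Iic, ← Set.inter_assoc, Set.Ici_inter_Ici, sup_eq_left.2 h0,
      Set.Ici_inter_Iic]
  rw [uniform01, measureReal_restrict_apply measurableSet_Ici, hinter,
    Real.volume_real_Icc_of_le h1]

lemma uniform01_Iio {τ : ℝ} (h0 : 0 ≤ τ) (h1 : τ ≤ 1) : uniform01.real (Set.Iio τ) = τ := by
  rw [← Set.compl_Ici, probReal_compl_eq_one_sub measurableSet_Ici, uniform01_Ici h0 h1,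
    sub_sub_cancel]

/-! ### Measurability of the rounds -/

local instance finsetMeasurableSpace {κ : Type*} : MeasurableSpace (Finset κ) := ⊤

local instance listMeasurableSpace {κ : Type*} : MeasurableSpace (List κ) := ⊤

local instance manisStateMeasurableSpace {m N : ℕ} : MeasurableSpace (ManisState m N) := ⊤

local instance coverStateMeasurableSpace {m N : ℕ} : MeasurableSpace (CoverState m N) := ⊤

instance {κ : Type*} : DiscreteMeasurableSpace (Finset κ) := ⟨fun _ => trivial⟩

instance {κ : Type*} : DiscreteMeasurableSpace (List κ) := ⟨fun _ => trivial⟩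

instance {m N : ℕ} : DiscreteMeasurableSpace (ManisState m N) := ⟨fun _ => trivial⟩

instance {m N : ℕ} : DiscreteMeasurableSpace (CoverState m N) := ⟨fun _ => trivial⟩

instance {m N : ℕ} : Countable (ManisState m N) :=
  Function.Injective.countable (f := fun s : ManisState m N => (s.A, s.B, s.out)) fun s t h => by
    cases s; cases t; simpa using h

instance {m N : ℕ} : Countable (CoverState m N) :=
  Function.Injective.countable (f := fun s : CoverState m N => (s.U, s.rem, s.out)) fun s t h => by
    cases s; cases t; simpa using h

section Measurability

variable {Z : Type*} [MeasurableSpace Z]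

lemma measurable_natCast_card {κ : Type*} {s : Z → Finset κ} (hs : Measurable s) :
    Measurable fun z => ((s z).card : ℝ) :=
  (Measurable.of_discrete (f := fun T : Finset κ => (T.card : ℝ))).comp hs

lemma measurable_mem_finset {κ : Type*} {s : Z → Finset κ} (hs : Measurable s) (i : κ) :
    Measurable fun z => i ∈ s z :=
  (Measurable.of_discrete (f := fun T : Finset κ => i ∈ T)).comp hs

lemma measurable_finset_filter {κ : Type*} [Countable κ] {s : Z → Finset κ} {p : Z → κ → Prop}
    [∀ z, DecidablePred (p z)] (hs : Measurable s) (hp : ∀ i, Measurable fun z => p z i) :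
    Measurable fun z => (s z).filter (p z) := by
  refine measurable_to_countable' fun T => ?_
  have hpreimage : (fun z => (s z).filter (p z)) ⁻¹' {T} =
      ⋂ i, {z | (i ∈ s z ∧ p z i) ↔ i ∈ T} := by
    ext z
    simp only [Set.mem_preimage, Set.mem_singleton_iff, Finset.ext_iff, Finset.mem_filter,
      Set.mem_iInter, Set.mem_ofPred_eq]
  rw [hpreimage]
  exact MeasurableSet.iInter fun i =>
    measurableSet_setOfPred.2 (((measurable_mem_finset hs i).and (hp i)).iff measurable_const)

variable {m N : ℕ} {x : Z → Fin m → ℝ} {A : Z → Finset (Fin m)} {B : Z → Finset (Fin N)}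

lemma measurable_picks (S : Fin m → Finset (Fin N)) (hA : Measurable A) (hB : Measurable B)
    (hx : ∀ a, Measurable fun z => x z a) (a : Fin m) :
    Measurable fun z => picks S (A z) (B z) (x z) a := by
  refine measurable_finset_filter hB fun b => ?_
  have hle : ∀ a', Measurable fun z => x z a' ≤ x z a := fun a' =>
    measurableSet_setOfPred.1 (measurableSet_le (hx a') (hx a))
  exact measurable_const.and (Measurable.forall fun a' =>
    (measurable_mem_finset hA a').imp (measurable_const.imp (hle a')))

open Classical in
lemma measurable_sortByPriority (hx : ∀ a, Measurable fun z => x z a) (hA : Measurable A) :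
    Measurable fun z => sortByPriority (x z) (A z) := by
  have hle : Measurable fun z => fun a a' : Fin m => x z a' ≤ x z a :=
    measurable_pi_iff.2 fun a => measurable_pi_iff.2 fun a' =>
      measurableSet_setOfPred.1 (measurableSet_le (hx a') (hx a))
  have hsort : Measurable fun p : (Fin m → Fin m → Prop) × Finset (Fin m) =>
      ((List.finRange m).filter fun a => a ∈ p.2).insertionSort p.1 := Measurable.of_discrete
  convert hsort.comp (hle.prodMk hA) using 2
  simp only [sortByPriority, Function.comp]

end Measurability

section Round

variable {m N : ℕ} (S : Fin m → Finset (Fin N)) {η θ : ℝ} {deg : Fin m → ℝ}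
  {s : ManisState m N} {ω : RoundTape m} {a : Fin m}

/-- The sets `J` that the round `manisStep` selects from the state `s`. -/
noncomputable def selected (η : ℝ) (deg : Fin m → ℝ) (s : ManisState m N) (ω : RoundTape m) :
    Finset (Fin m) :=
  s.A.filter fun a =>
    ((picks S s.A s.B (fun a => (ω a).1) a).card : ℝ) + (ω a).2.1 ≥ (1 - 4 * η) * deg a

lemma mem_selected : a ∈ selected S η deg s ω ↔ a ∈ s.A ∧ (1 - 4 * η) * deg a ≤
    (picks S s.A s.B (fun a => (ω a).1) a).card + (ω a).2.1 :=
  Finset.mem_filter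

lemma manisStep_out : (manisStep S η θ deg s ω).out =
    s.out ++ sortByPriority (fun a => (ω a).1) (selected S η deg s ω) := by
  unfold manisStep selected
  congr

lemma manisStep_B : (manisStep S η θ deg s ω).B = s.B \ (selected S η deg s ω).biUnion S := by
  unfold manisStep selected
  congr

lemma manisStep_B_subset : (manisStep S η θ deg s ω).B ⊆ s.B :=
  manisStep_B S ▸ Finset.sdiff_subset

lemma mem_manisStep_A : a ∈ (manisStep S η θ deg s ω).A ↔ a ∈ s.A ∧ a ∉ selected S η deg s ω ∧
    (1 - η) * deg a + θ ≤ (S a ∩ (manisStep S η θ deg s ω).B).card + (ω a).2.2 := by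
  classical
  have hB : S a ∩ s.B ∩ (manisStep S η θ deg s ω).B = S a ∩ (manisStep S η θ deg s ω).B := by
    rw [Finset.inter_assoc, Finset.inter_eq_right.2 (manisStep_B_subset S)]
  rw [← hB, manisStep_B]
  simp only [manisStep, selected, Finset.mem_filter, Finset.mem_sdiff, and_assoc, ge_iff_le]

end Round

lemma measurable_selected {Z : Type*} [MeasurableSpace Z] {m N : ℕ} (S : Fin m → Finset (Fin N))
    (η : ℝ) {deg : Z → Fin m → ℝ} {s : Z → ManisState m N} {ω : Z → RoundTape m}
    (hdeg : ∀ a, Measurable fun z => deg z a) (hs : Measurable s)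
    (hω : ∀ a, Measurable fun z => ω z a) :
    Measurable fun z => selected S η (deg z) (s z) (ω z) :=
  have hA : Measurable fun z => (s z).A := (Measurable.of_discrete (f := ManisState.A)).comp hs
  have hB : Measurable fun z => (s z).B := (Measurable.of_discrete (f := ManisState.B)).comp hs
  measurable_finset_filter hA fun a => measurableSet_setOfPred.1 <|
    measurableSet_le ((hdeg a).const_mul _)
      ((measurable_natCast_card (measurable_picks S hA hB (fun a => (hω a).fst) a)).add
        (hω a).snd.fst)

lemma measurable_manisStep {Z : Type*} [MeasurableSpace Z] {m N : ℕ} (S : Fin m → Finset (Fin N))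
    (η θ : ℝ) {deg : Z → Fin m → ℝ} {s : Z → ManisState m N} {ω : Z → RoundTape m}
    (hdeg : ∀ a, Measurable fun z => deg z a) (hs : Measurable s)
    (hω : ∀ a, Measurable fun z => ω z a) :
    Measurable fun z => manisStep S η θ (deg z) (s z) (ω z) := by
  classical
  have hsel := measurable_selected S η hdeg hs hω
  have hB : Measurable fun z => (manisStep S η θ (deg z) (s z) (ω z)).B := by
    simp only [manisStep_B]
    exact (Measurable.of_discrete (f := fun p : ManisState m N × Finset (Fin m) =>
      p.1.B \ p.2.biUnion S)).comp (hs.prodMk hsel)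
  have hA : Measurable fun z => (manisStep S η θ (deg z) (s z) (ω z)).A := by
    have hfilter : (fun z => (manisStep S η θ (deg z) (s z) (ω z)).A) =
        fun z => (s z).A.filter fun a => a ∉ selected S η (deg z) (s z) (ω z) ∧
          (1 - η) * deg z a + θ ≤
            (S a ∩ (manisStep S η θ (deg z) (s z) (ω z)).B).card + (ω z a).2.2 := by
      ext z a
      rw [mem_manisStep_A, Finset.mem_filter]
    rw [hfilter]
    refine measurable_finset_filter ((Measurable.of_discrete (f := ManisState.A)).comp hs)
      fun a => (measurable_mem_finset hsel a).not.and <| measurableSet_setOfPred.1 <|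
        measurableSet_le (((hdeg a).const_mul _).add_const _) (.add ?_ (hω a).snd.snd)
    exact (Measurable.of_discrete (f := fun T : Finset (Fin N) => ((S a ∩ T).card : ℝ))).comp hB
  have hout : Measurable fun z => (manisStep S η θ (deg z) (s z) (ω z)).out := by
    simp only [manisStep_out]
    exact (Measurable.of_discrete (f := fun p : ManisState m N × List (Fin m) =>
      p.1.out ++ p.2)).comp (hs.prodMk (measurable_sortByPriority (fun a => (hω a).fst) hsel))
  exact (Measurable.of_discrete (f := fun p : Finset (Fin m) × Finset (Fin N) × List (Fin m) =>
    (⟨p.1, p.2.1, p.2.2⟩ : ManisState m N))).comp (hA.prodMk (hB.prodMk hout))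

/-! ### Expected decay of the edges in one round -/

lemma measureReal_pi_finset {ι α : Type*} [Fintype ι] [MeasurableSpace α] (μ : ι → Measure α)
    [∀ i, IsProbabilityMeasure (μ i)] (s : Finset ι) (f : ι → Set α) :
    (Measure.pi μ).real ((s : Set ι).pi f) = ∏ i ∈ s, (μ i).real (f i) := by
  simp [measureReal_def, Measure.pi_pi_finset, ENNReal.toReal_prod]

lemma measureReal_pi_finset_inter {ι α : Type*} [Fintype ι] [MeasurableSpace α]
    (μ : ι → Measure α) [∀ i, IsProbabilityMeasure (μ i)] {s : Finset ι} {i : ι} (hi : i ∉ s)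
    (f : ι → Set α) (E : Set α) :
    (Measure.pi μ).real ((s : Set ι).pi f ∩ {ω | ω i ∈ E}) =
      (μ i).real E * (Measure.pi μ).real ((s : Set ι).pi f) := by
  classical
  have hne : ∀ j ∈ s, j ≠ i := fun j hj => ne_of_mem_of_not_mem hj hi
  have hbox : (s : Set ι).pi f ∩ {ω | ω i ∈ E} =
      ((insert i s : Finset ι) : Set ι).pi (Function.update f i E) := by
    ext ω
    simp +contextual [Set.mem_pi, hne, and_comm]
  rw [hbox, measureReal_pi_finset, measureReal_pi_finset, Finset.prod_insert hi,
    Function.update_self]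
  congr 1
  exact Finset.prod_congr rfl fun j hj => by rw [Function.update_of_ne (hne j hj)]

/-- The law of the draws of one round, with noise of scale `β`. -/
noncomputable def roundLaw (m : ℕ) (β : ℝ) : Measure (RoundTape m) :=
  Measure.pi fun _ : Fin m => uniform01.prod ((laplace β).prod (laplace β))

lemma isProbabilityMeasure_roundLaw (m : ℕ) {β : ℝ} (hβ : 0 < β) :
    IsProbabilityMeasure (roundLaw m β) := by
  have := isProbabilityMeasure_laplace hβ
  unfold roundLaw
  infer_instance

section LeadEvent

variable {m : ℕ} {β τ : ℝ} {C : Finset (Fin m)} {a : Fin m}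

/-- The event that `a` alone has priority at least `τ` among `a` and the sets of `C`, and that its
selection noise is nonnegative. -/
def leadEvent (C : Finset (Fin m)) (τ : ℝ) (a : Fin m) : Set (RoundTape m) :=
  {ω | (τ ≤ (ω a).1 ∧ 0 ≤ (ω a).2.1) ∧ ∀ a' ∈ C.erase a, (ω a').1 < τ}

lemma leadEvent_eq_pi : leadEvent C τ a = ((insert a (C.erase a) : Finset (Fin m)) : Set _).pi
    fun j => if j = a then Set.Ici τ ×ˢ Set.Ici 0 ×ˢ Set.univ else Set.Iio τ ×ˢ Set.univ := by
  ext ω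
  simp only [leadEvent, Set.mem_ofPred_eq, Set.mem_pi, Finset.mem_coe, Finset.forall_mem_insert]
  refine and_congr (by simp) (forall₂_congr fun a' ha' => ?_)
  simp [Finset.ne_of_mem_erase ha']

lemma measurableSet_leadEvent : MeasurableSet (leadEvent C τ a) := by
  rw [leadEvent_eq_pi]
  refine MeasurableSet.pi (Finset.countable_toSet _) fun j _ => ?_
  split_ifs
  · exact measurableSet_Ici.prod (measurableSet_Ici.prod .univ)
  · exact measurableSet_Iio.prod .univ

lemma measureReal_leadEvent (hβ : 0 < β) (h0 : 0 ≤ τ) (h1 : τ ≤ 1) :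
    (roundLaw m β).real (leadEvent C τ a) =
      (1 - τ) * (laplace β).real (Set.Ici 0) * τ ^ (C.erase a).card := by
  have := isProbabilityMeasure_laplace hβ
  have hother : ∀ j ∈ C.erase a, (uniform01.prod ((laplace β).prod (laplace β))).real
      (if j = a then Set.Ici τ ×ˢ Set.Ici 0 ×ˢ Set.univ else Set.Iio τ ×ˢ Set.univ) = τ := by
    intro j hj
    rw [if_neg (Finset.ne_of_mem_erase hj), measureReal_prod_prod, uniform01_Iio h0 h1,
      probReal_univ, mul_one]
  rw [roundLaw, leadEvent_eq_pi, measureReal_pi_finset,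
    Finset.prod_insert (Finset.notMem_erase a C), Finset.prod_congr rfl hother, Finset.prod_const,
    if_pos rfl, measureReal_prod_prod, measureReal_prod_prod, uniform01_Ici h0 h1, probReal_univ,
    mul_one]

lemma div_card_le_measureReal_leadEvent (hβ : 0 < β) {σ : ℝ} (h0 : 0 ≤ σ) (h1 : σ ≤ 1)
    (ha : a ∈ C) :
    σ * (1 - σ) / 2 / C.card ≤ (roundLaw m β).real (leadEvent C (1 - σ / C.card) a) := by
  have hC : 1 ≤ C.card := Finset.card_pos.2 ⟨a, ha⟩
  have hC' : (1 : ℝ) ≤ C.card := by exact_mod_cast hC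
  have hσ0 : 0 ≤ σ / C.card := by positivity
  have hσ1 : σ / C.card ≤ 1 := div_le_one_of_le₀ (h1.trans hC') (by positivity)
  have hbernoulli : 1 - σ ≤ (1 - σ / C.card) ^ (C.erase a).card := by
    calc 1 - σ = 1 + C.card * -(σ / C.card) := by field_simp; ring
      _ ≤ 1 + (C.erase a).card * -(σ / C.card) := by
        have : ((C.erase a).card : ℝ) ≤ C.card := by exact_mod_cast Finset.card_erase_le
        nlinarith
      _ ≤ (1 - σ / C.card) ^ (C.erase a).card := by
        rw [sub_eq_add_neg]
        exact one_add_mul_le_pow (by linarith) _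
  rw [measureReal_leadEvent hβ (sub_nonneg.2 hσ1) (sub_le_self 1 hσ0), sub_sub_cancel]
  calc σ * (1 - σ) / 2 / C.card = σ / C.card * (1 / 2) * (1 - σ) := by ring
    _ ≤ σ / C.card * (laplace β).real (Set.Ici 0) * (1 - σ / C.card) ^ (C.erase a).card := by
      have := half_le_laplace_Ici hβ
      gcongr

lemma measureReal_leadEvent_inter_le (hβ : 0 < β) (h0 : 0 ≤ τ) (h1 : τ ≤ 1) {a' : Fin m}
    (hne : a' ≠ a) :
    (roundLaw m β).real (leadEvent C τ a ∩ {ω | τ ≤ (ω a').1}) ≤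
      (1 - τ) * (roundLaw m β).real (leadEvent C τ a) := by
  have := isProbabilityMeasure_laplace hβ
  by_cases ha' : a' ∈ C
  · have hempty : leadEvent C τ a ∩ {ω | τ ≤ (ω a').1} = ∅ :=
      Set.eq_empty_of_forall_notMem fun ω hω =>
        (hω.1.2 a' (Finset.mem_erase.2 ⟨hne, ha'⟩)).not_ge hω.2
    rw [hempty, measureReal_empty]
    exact mul_nonneg (sub_nonneg.2 h1) measureReal_nonneg
  · have hcyl : {ω : RoundTape m | τ ≤ (ω a').1} = {ω | ω a' ∈ Set.Ici τ ×ˢ Set.univ} := by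
      simp
    rw [roundLaw, leadEvent_eq_pi, hcyl, measureReal_pi_finset_inter _ (by simp [hne, ha']),
      measureReal_prod_prod, uniform01_Ici h0 h1, probReal_univ, mul_one]

end LeadEvent

section Edges

variable {m N : ℕ} (S : Fin m → Finset (Fin N)) (s : ManisState m N)

/-- The remaining sets that contain `b`. -/
def covering (b : Fin N) : Finset (Fin m) := s.A.filter fun a => b ∈ S a

/-- The pairs of a remaining set and a remaining element contained in it. -/
def edges : Finset (Fin m × Fin N) := (s.A ×ˢ s.B).filter fun e => e.2 ∈ S e.1

/-- The remaining elements of `a` whose degree is exceeded by that of at most a fraction `η` of the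
remaining elements of `a`. -/
noncomputable def lowDegree (η : ℝ) (a : Fin m) : Finset (Fin N) :=
  {b ∈ S a ∩ s.B | (((S a ∩ s.B).filter fun b' =>
    (covering S s b).card < (covering S s b').card).card : ℝ) ≤ η * (S a ∩ s.B).card}

/-- The event that some remaining set other than `a` that contains `b` has priority at least `τ`. -/
def contestedEvent (τ : ℝ) (a : Fin m) (b : Fin N) : Set (RoundTape m) :=
  {ω | ∃ c ∈ (covering S s b).erase a, τ ≤ (ω c).1}

/-- The event that `a` is selected and has the strictly largest priority among the remaining sets
that contain `b`. -/
def winEvent (η : ℝ) (deg : Fin m → ℝ) (a : Fin m) (b : Fin N) : Set (RoundTape m) :=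
  {ω | a ∈ selected S η deg s ω ∧ ∀ a' ∈ (covering S s b).erase a, (ω a').1 < (ω a).1}

variable {S s} {β η θ τ : ℝ} {deg : Fin m → ℝ} {C : Finset (Fin m)} {a : Fin m} {b : Fin N}

lemma mem_covering : a ∈ covering S s b ↔ a ∈ s.A ∧ b ∈ S a := Finset.mem_filter

lemma mem_edges {e : Fin m × Fin N} : e ∈ edges S s ↔ (e.1 ∈ s.A ∧ e.2 ∈ s.B) ∧ e.2 ∈ S e.1 := by
  rw [edges, Finset.mem_filter, Finset.mem_product]

lemma mul_card_le_card_filter_exceeded {κ : Type*} (X : Finset κ) (f : κ → ℕ) (hη : η ≤ 1) :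
    η * X.card ≤
      (X.filter fun b => ((X.filter fun b' => f b < f b').card : ℝ) ≤ η * X.card).card := by
  classical
  set G := X.filter fun b => ((X.filter fun b' => f b < f b').card : ℝ) ≤ η * X.card
  rcases (X \ G).eq_empty_or_nonempty with hempty | hne
  · have hXG : X ⊆ G := Finset.sdiff_eq_empty_iff_subset.1 hempty
    calc η * X.card ≤ X.card := mul_le_of_le_one_left (Nat.cast_nonneg _) hη
      _ ≤ G.card := by exact_mod_cast Finset.card_le_card hXG
  · -- All elements exceeding a maximal element outside `G` belong to `G`.
    obtain ⟨b, hb, hmax⟩ := Finset.exists_max_image (X \ G) f hne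
    obtain ⟨hbX, hbG⟩ := Finset.mem_sdiff.1 hb
    have hsub : X.filter (fun b' => f b < f b') ⊆ G := fun b' hb' => by
      obtain ⟨hb'X, hlt⟩ := Finset.mem_filter.1 hb'
      by_contra hb'G
      exact (hmax b' (Finset.mem_sdiff.2 ⟨hb'X, hb'G⟩)).not_gt hlt
    have hmany : η * X.card < (X.filter fun b' => f b < f b').card :=
      not_le.1 fun hle => hbG (Finset.mem_filter.2 ⟨hbX, hle⟩)
    exact hmany.le.trans (by exact_mod_cast Finset.card_le_card hsub)

lemma measurableSet_contestedEvent : MeasurableSet (contestedEvent S s τ a b) := by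
  have hunion : contestedEvent S s τ a b =
      ⋃ a' ∈ (covering S s b).erase a, {ω | τ ≤ (ω a').1} := by
    ext ω
    simp only [contestedEvent, Set.mem_ofPred_eq, Set.mem_iUnion, exists_prop]
  rw [hunion]
  exact Finset.measurableSet_biUnion _ fun a' _ =>
    measurableSet_le measurable_const (measurable_pi_apply a').fst

lemma measurableSet_winEvent : MeasurableSet (winEvent S s η deg a b) := by
  have hsel : Measurable fun ω : RoundTape m => selected S η deg s ω :=
    measurable_selected S η (fun _ => measurable_const) measurable_const measurable_pi_apply
  refine measurableSet_setOfPred.2 ((measurable_mem_finset hsel a).and ?_)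
  exact Measurable.forall fun a' => measurable_const.imp (measurableSet_setOfPred.1
    (measurableSet_lt (measurable_pi_apply a').fst (measurable_pi_apply a).fst))

lemma measureReal_leadEvent_inter_contestedEvent_le (hβ : 0 < β) (h0 : 0 ≤ τ) (h1 : τ ≤ 1) :
    (roundLaw m β).real (leadEvent C τ a ∩ contestedEvent S s τ a b) ≤
      (covering S s b).card * (1 - τ) * (roundLaw m β).real (leadEvent C τ a) := by
  have hunion : leadEvent C τ a ∩ contestedEvent S s τ a b =
      ⋃ a' ∈ (covering S s b).erase a, leadEvent C τ a ∩ {ω | τ ≤ (ω a').1} := by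
    ext ω
    simp only [contestedEvent, Set.mem_inter_iff, Set.mem_ofPred_eq, Set.mem_iUnion, exists_prop]
    tauto
  have := isProbabilityMeasure_roundLaw m hβ
  have : 0 ≤ 1 - τ := sub_nonneg.2 h1
  calc (roundLaw m β).real (leadEvent C τ a ∩ contestedEvent S s τ a b)
      ≤ ∑ a' ∈ (covering S s b).erase a,
          (roundLaw m β).real (leadEvent C τ a ∩ {ω | τ ≤ (ω a').1}) :=
        hunion ▸ measureReal_biUnion_finset_le _ _
    _ ≤ ∑ _a' ∈ (covering S s b).erase a, (1 - τ) * (roundLaw m β).real (leadEvent C τ a) :=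
        Finset.sum_le_sum fun a' ha' =>
          measureReal_leadEvent_inter_le hβ h0 h1 (Finset.ne_of_mem_erase ha')
    _ = ((covering S s b).erase a).card * (1 - τ) * (roundLaw m β).real (leadEvent C τ a) := by
        rw [Finset.sum_const, nsmul_eq_mul, mul_assoc]
    _ ≤ (covering S s b).card * (1 - τ) * (roundLaw m β).real (leadEvent C τ a) := by
        gcongr
        exact Finset.erase_subset _ _

open Classical in
lemma measureReal_leadEvent_inter_many_contested_le (hβ : 0 < β) (h0 : 0 ≤ τ) (h1 : τ ≤ 1)
    {σ t : ℝ} (ht : 0 ≤ t) {I : Finset (Fin N)}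
    (hI : ∀ b ∈ I, (covering S s b).card * (1 - τ) ≤ σ) :
    t * (roundLaw m β).real (leadEvent C τ a ∩
        {ω | t ≤ (I.filter fun b => ω ∈ contestedEvent S s τ a b).card}) ≤
      I.card * σ * (roundLaw m β).real (leadEvent C τ a) := by
  have := isProbabilityMeasure_roundLaw m hβ
  have hmarkov := mul_measureReal_le_card_filter_mem_le I
    ((roundLaw m β).restrict (leadEvent C τ a))
    (fun b _ => measurableSet_contestedEvent (S := S) (s := s) (τ := τ) (a := a) (b := b)) ht
  rw [measureReal_restrict_apply' measurableSet_leadEvent, Set.inter_comm] at hmarkov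
  refine hmarkov.trans ?_
  calc ∑ b ∈ I, ((roundLaw m β).restrict (leadEvent C τ a)).real (contestedEvent S s τ a b)
      ≤ ∑ _b ∈ I, σ * (roundLaw m β).real (leadEvent C τ a) := by
        refine Finset.sum_le_sum fun b hb => ?_
        rw [measureReal_restrict_apply' measurableSet_leadEvent, Set.inter_comm]
        exact (measureReal_leadEvent_inter_contestedEvent_le hβ h0 h1).trans
          (mul_le_mul_of_nonneg_right (hI b hb) measureReal_nonneg)
    _ = I.card * σ * (roundLaw m β).real (leadEvent C τ a) := by
        rw [Finset.sum_const, nsmul_eq_mul, mul_assoc]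

open Classical in
lemma half_measureReal_leadEvent_le_sdiff (hβ : 0 < β) (h0 : 0 ≤ τ) (h1 : τ ≤ 1) {σ t : ℝ}
    (ht : 0 < t) {I : Finset (Fin N)} (hI : ∀ b ∈ I, (covering S s b).card * (1 - τ) ≤ σ)
    (hσ : I.card * σ ≤ t / 2) :
    (roundLaw m β).real (leadEvent C τ a) / 2 ≤ (roundLaw m β).real (leadEvent C τ a \
      {ω | t ≤ (I.filter fun b => ω ∈ contestedEvent S s τ a b).card}) := by
  have := isProbabilityMeasure_roundLaw m hβ
  set many : Set (RoundTape m) :=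
    {ω | t ≤ (I.filter fun b => ω ∈ contestedEvent S s τ a b).card}
  have hmany : MeasurableSet many :=
    measurableSet_le measurable_const <| measurable_natCast_card <|
      measurable_finset_filter measurable_const fun _ =>
        measurableSet_setOfPred.1 measurableSet_contestedEvent
  have hinter : (roundLaw m β).real (leadEvent C τ a ∩ many) ≤
      (roundLaw m β).real (leadEvent C τ a) / 2 := by
    refine le_of_mul_le_mul_left ?_ ht
    calc t * (roundLaw m β).real (leadEvent C τ a ∩ many)
        ≤ I.card * σ * (roundLaw m β).real (leadEvent C τ a) :=
          measureReal_leadEvent_inter_many_contested_le hβ h0 h1 ht.le hI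
      _ ≤ t / 2 * (roundLaw m β).real (leadEvent C τ a) := by gcongr
      _ = t * ((roundLaw m β).real (leadEvent C τ a) / 2) := by ring
  linarith [measureReal_inter_add_sdiff (μ := roundLaw m β) (s := leadEvent C τ a) hmany]

lemma mem_picks_of_notMem_contestedEvent {ω : RoundTape m} (hω : τ ≤ (ω a).1)
    (hb : b ∈ S a ∩ s.B) (hcontested : ω ∉ contestedEvent S s τ a b) :
    b ∈ picks S s.A s.B (fun a => (ω a).1) a := by
  obtain ⟨hba, hbB⟩ := Finset.mem_inter.1 hb
  refine Finset.mem_filter.2 ⟨hbB, hba, fun a' ha' hba' => ?_⟩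
  rcases eq_or_ne a' a with rfl | hne
  · exact le_rfl
  by_contra hlt
  exact hcontested ⟨a', Finset.mem_erase.2 ⟨hne, mem_covering.2 ⟨ha', hba'⟩⟩,
    hω.trans (not_le.1 hlt).le⟩

open Classical in
lemma mem_winEvent_of_few_contested (hη : 0 ≤ η) (hη' : η ≤ 1 / 4) (ha : a ∈ s.A)
    (hdeg : (1 - η) * deg a ≤ (S a ∩ s.B).card) (hb : b ∈ lowDegree S s η a) {ω : RoundTape m}
    (hlead : ω ∈ leadEvent (covering S s b) τ a)
    (hfew : (((S a ∩ s.B).filter fun b' => (covering S s b').card ≤ (covering S s b).card).filter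
      fun b' => ω ∈ contestedEvent S s τ a b').card < η * (S a ∩ s.B).card) :
    ω ∈ winEvent S s η deg a b := by
  obtain ⟨⟨hprio, hnoise⟩, hother⟩ := hlead
  refine ⟨(mem_selected S).2 ⟨ha, ?_⟩, fun a' ha' => (hother a' ha').trans_le hprio⟩
  set P := picks S s.A s.B (fun a => (ω a).1) a
  set high := (S a ∩ s.B).filter fun b' => (covering S s b).card < (covering S s b').card
  set low := (S a ∩ s.B).filter fun b' => (covering S s b').card ≤ (covering S s b).card
  have hcover : S a ∩ s.B ⊆ P ∪ (high ∪ low.filter fun b' => ω ∈ contestedEvent S s τ a b') := by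
    intro b' hb'
    have hpick := mem_picks_of_notMem_contestedEvent hprio hb'
    have hcases := lt_or_ge (covering S s b).card (covering S s b').card
    simp only [Finset.mem_union, Finset.mem_filter, high, low]
    tauto
  have hcard : ((S a ∩ s.B).card : ℝ) ≤ P.card +
      (high.card + (low.filter fun b' => ω ∈ contestedEvent S s τ a b').card) := by
    exact_mod_cast (Finset.card_le_card hcover).trans ((Finset.card_union_le _ _).trans
      (Nat.add_le_add_left (Finset.card_union_le _ _) _))
  have hhigh : (high.card : ℝ) ≤ η * (S a ∩ s.B).card := (Finset.mem_filter.1 hb).2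
  have hpicked : (1 - 2 * η) * (S a ∩ s.B).card ≤ P.card := by linarith
  have hselected : (1 - 4 * η) * deg a ≤ P.card := by
    rcases le_total 0 (deg a) with hpos | hneg
    · calc (1 - 4 * η) * deg a ≤ (1 - 2 * η) * ((1 - η) * deg a) := by
            nlinarith [mul_nonneg hη hpos, mul_nonneg (sq_nonneg η) hpos]
        _ ≤ (1 - 2 * η) * (S a ∩ s.B).card := mul_le_mul_of_nonneg_left hdeg (by linarith)
        _ ≤ P.card := hpicked
    · exact (mul_nonpos_of_nonneg_of_nonpos (by linarith) hneg).trans (Nat.cast_nonneg _)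
  linarith

/-- A lower bound for the degree of `b` times the probability that `a` wins `b`. -/
noncomputable def winRate (η : ℝ) : ℝ := η / 2 * (1 - η / 2) / 4

lemma winRate_div_card_le_measureReal_winEvent (hβ : 0 < β) (hη : 0 < η) (hη' : η ≤ 1 / 4)
    (ha : a ∈ s.A) (hdeg : (1 - η) * deg a ≤ (S a ∩ s.B).card) (hb : b ∈ lowDegree S s η a) :
    winRate η / (covering S s b).card ≤ (roundLaw m β).real (winEvent S s η deg a b) := by
  classical
  have := isProbabilityMeasure_roundLaw m hβ
  have hbS : b ∈ S a ∩ s.B := (Finset.mem_filter.1 hb).1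
  have hcov : a ∈ covering S s b := mem_covering.2 ⟨ha, (Finset.mem_inter.1 hbS).1⟩
  have hd : (1 : ℝ) ≤ (covering S s b).card := Nat.one_le_cast.2 (Finset.card_pos.2 ⟨a, hcov⟩)
  have hD : (0 : ℝ) < (S a ∩ s.B).card := Nat.cast_pos.2 (Finset.card_pos.2 ⟨b, hbS⟩)
  set τ := 1 - η / 2 / (covering S s b).card with hτ
  have hτ0 : 0 ≤ τ := sub_nonneg.2 (div_le_one_of_le₀ (by linarith) (by linarith))
  have hτ1 : τ ≤ 1 := sub_le_self 1 (by positivity)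
  set low := (S a ∩ s.B).filter fun b' => (covering S s b').card ≤ (covering S s b).card
  have hlow : ∀ b' ∈ low, (covering S s b').card * (1 - τ) ≤ η / 2 := fun b' hb' => by
    have hle : ((covering S s b').card : ℝ) ≤ (covering S s b).card :=
      Nat.cast_le.2 (Finset.mem_filter.1 hb').2
    calc (covering S s b').card * (1 - τ)
        ≤ (covering S s b).card * (η / 2 / (covering S s b).card) := by
          rw [hτ, sub_sub_cancel]
          gcongr
      _ = η / 2 := by field_simp
  have hlowD : low.card * (η / 2) ≤ η * (S a ∩ s.B).card / 2 := by
    have : (low.card : ℝ) ≤ (S a ∩ s.B).card := Nat.cast_le.2 (Finset.card_filter_le _ _)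
    nlinarith
  calc winRate η / (covering S s b).card
      = η / 2 * (1 - η / 2) / 2 / (covering S s b).card / 2 := by rw [winRate]; ring
    _ ≤ (roundLaw m β).real (leadEvent (covering S s b) τ a) / 2 := by
      have := div_card_le_measureReal_leadEvent hβ (σ := η / 2) (by linarith) (by linarith) hcov
      linarith
    _ ≤ _ := half_measureReal_leadEvent_le_sdiff hβ hτ0 hτ1 (mul_pos hη hD) hlow hlowD
    _ ≤ (roundLaw m β).real (winEvent S s η deg a b) :=
      measureReal_mono fun ω hω =>
        mem_winEvent_of_few_contested hη.le hη' ha hdeg hb hω.1 (not_le.1 hω.2)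

end Edges

section RoundDecay

variable {m N : ℕ} (S : Fin m → Finset (Fin N)) (η θ : ℝ) (deg : Fin m → ℝ) (s : ManisState m N)

/-- The remaining sets that would pass a noiseless survival test if the round removed nothing. -/
noncomputable def viable : Finset (Fin m) := {a ∈ s.A | (1 - η) * deg a + θ ≤ (S a ∩ s.B).card}

/-- The event that `e` is not an edge after the round. -/
def lostEvent (e : Fin m × Fin N) : Set (RoundTape m) :=
  {ω | e ∉ edges S (manisStep S η θ deg s ω)}

variable {S η θ deg s} {β : ℝ}

lemma measurableSet_lostEvent (e : Fin m × Fin N) : MeasurableSet (lostEvent S η θ deg s e) :=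
  have hstep : Measurable fun ω : RoundTape m => manisStep S η θ deg s ω :=
    measurable_manisStep S η θ (fun _ => measurable_const) measurable_const measurable_pi_apply
  hstep (MeasurableSet.of_discrete (s := {t : ManisState m N | e ∉ edges S t}))

lemma half_le_measureReal_lostEvent (hβ : 0 < β) {e : Fin m × Fin N}
    (he : e ∈ edges S s) (hviable : e.1 ∉ viable S η θ deg s) :
    1 / 2 ≤ (roundLaw m β).real (lostEvent S η θ deg s e) := by
  have := isProbabilityMeasure_laplace hβ
  have := isProbabilityMeasure_roundLaw m hβ
  have hnoise : (roundLaw m β).real {ω | ω e.1 ∈ Set.univ ×ˢ Set.univ ×ˢ Set.Iic 0} =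
      (laplace β).real (Set.Iic 0) := by
    refine ((measurePreserving_eval _ e.1).measureReal_preimage (MeasurableSet.univ.prod
      (MeasurableSet.univ.prod measurableSet_Iic)).nullMeasurableSet).trans ?_
    rw [measureReal_prod_prod, measureReal_prod_prod, probReal_univ, probReal_univ, one_mul,
      one_mul]
  refine (half_le_laplace_Iic hβ).trans (hnoise ▸ measureReal_mono fun ω hω hsurvives => ?_)
  have hpassed := ((mem_manisStep_A S).1 (mem_edges.1 hsurvives).1.1).2.2
  have hcard : ((S e.1 ∩ (manisStep S η θ deg s ω).B).card : ℝ) ≤ (S e.1 ∩ s.B).card :=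
    Nat.cast_le.2 (Finset.card_le_card (Finset.inter_subset_inter_left (manisStep_B_subset S)))
  have hnonpos : (ω e.1).2.2 ≤ 0 := hω.2.2
  exact hviable (Finset.mem_filter.2 ⟨(mem_edges.1 he).1.1, by linarith⟩)

open Classical in
lemma winRate_mul_card_le (hβ : 0 < β) (hη : 0 < η) (hη' : η ≤ 1 / 4) (hθ : 0 ≤ θ) (b : Fin N) :
    winRate η * {a ∈ covering S s b | a ∈ viable S η θ deg s ∧ b ∈ lowDegree S s η a}.card ≤
      (covering S s b).card * (roundLaw m β).real {ω | b ∉ (manisStep S η θ deg s ω).B} := by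
  have := isProbabilityMeasure_roundLaw m hβ
  set G := {a ∈ covering S s b | a ∈ viable S η θ deg s ∧ b ∈ lowDegree S s η a}
  have hGC : G ⊆ covering S s b := Finset.filter_subset _ _
  rcases (covering S s b).eq_empty_or_nonempty with hempty | hne
  · simp [Finset.subset_empty.1 (hempty ▸ hGC), hempty]
  have hd : (0 : ℝ) < (covering S s b).card := Nat.cast_pos.2 hne.card_pos
  have hdisjoint : Set.PairwiseDisjoint (G : Set (Fin m)) fun a => winEvent S s η deg a b :=
    fun a ha a' ha' haa' => Set.disjoint_left.2 fun ω hω hω' =>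
      lt_asymm (hω.2 a' (Finset.mem_erase.2 ⟨haa'.symm, hGC ha'⟩))
        (hω'.2 a (Finset.mem_erase.2 ⟨haa', hGC ha⟩))
  have hremoved : (⋃ a ∈ G, winEvent S s η deg a b) ⊆ {ω | b ∉ (manisStep S η θ deg s ω).B} := by
    refine Set.iUnion₂_subset fun a ha ω hω hb => ?_
    rw [manisStep_B, Finset.mem_sdiff] at hb
    exact hb.2 (Finset.mem_biUnion.2 ⟨a, hω.1, (mem_covering.1 (hGC ha)).2⟩)
  rw [← div_le_iff₀' hd]
  calc winRate η * G.card / (covering S s b).card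
      = ∑ _a ∈ G, winRate η / (covering S s b).card := by
        rw [Finset.sum_const, nsmul_eq_mul]
        ring
    _ ≤ ∑ a ∈ G, (roundLaw m β).real (winEvent S s η deg a b) := by
        refine Finset.sum_le_sum fun a ha => ?_
        obtain ⟨-, haviable, hlow⟩ := Finset.mem_filter.1 ha
        obtain ⟨haA, hdeg⟩ := Finset.mem_filter.1 haviable
        exact winRate_div_card_le_measureReal_winEvent hβ hη hη' haA (by linarith) hlow
    _ = (roundLaw m β).real (⋃ a ∈ G, winEvent S s η deg a b) :=
        (measureReal_biUnion_finset hdisjoint fun _ _ => measurableSet_winEvent).symm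
    _ ≤ (roundLaw m β).real {ω | b ∉ (manisStep S η θ deg s ω).B} := measureReal_mono hremoved

lemma sum_edges_eq_sum_elements (f : Fin m × Fin N → ℝ) :
    ∑ e ∈ edges S s, f e = ∑ b ∈ s.B, ∑ a ∈ covering S s b, f (a, b) := by
  simp only [edges, covering, Finset.sum_filter, Finset.sum_product_right]

lemma sum_edges_eq_sum_sets (f : Fin m × Fin N → ℝ) :
    ∑ e ∈ edges S s, f e = ∑ a ∈ s.A, ∑ b ∈ S a ∩ s.B, f (a, b) := by
  simp only [edges, Finset.sum_filter, Finset.sum_product]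
  refine Finset.sum_congr rfl fun a _ => ?_
  rw [← Finset.sum_filter, Finset.filter_mem_eq_inter, Finset.inter_comm]

open Classical in
lemma half_mul_card_le_sum_lostEvent (hβ : 0 < β) :
    1 / 2 * ({e ∈ edges S s | e.1 ∉ viable S η θ deg s}.card : ℝ) ≤
      ∑ e ∈ edges S s, (roundLaw m β).real (lostEvent S η θ deg s e) := by
  rw [mul_comm, ← nsmul_eq_mul, ← Finset.sum_const, Finset.sum_filter]
  refine Finset.sum_le_sum fun e he => ?_
  split_ifs with hviable
  · exact measureReal_nonneg
  · exact half_le_measureReal_lostEvent hβ he hviable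

open Classical in
lemma winRate_mul_card_le_sum_lostEvent (hβ : 0 < β) (hη : 0 < η) (hη' : η ≤ 1 / 4)
    (hθ : 0 ≤ θ) :
    winRate η * {e ∈ edges S s | e.1 ∈ viable S η θ deg s ∧ e.2 ∈ lowDegree S s η e.1}.card ≤
      ∑ e ∈ edges S s, (roundLaw m β).real (lostEvent S η θ deg s e) := by
  have := isProbabilityMeasure_roundLaw m hβ
  rw [Finset.natCast_card_filter, sum_edges_eq_sum_elements, sum_edges_eq_sum_elements,
    Finset.mul_sum]
  refine Finset.sum_le_sum fun b _ => ?_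
  calc winRate η * ∑ a ∈ covering S s b,
        (if a ∈ viable S η θ deg s ∧ b ∈ lowDegree S s η a then (1 : ℝ) else 0)
      ≤ (covering S s b).card * (roundLaw m β).real {ω | b ∉ (manisStep S η θ deg s ω).B} := by
        rw [← Finset.natCast_card_filter]
        exact winRate_mul_card_le hβ hη hη' hθ b
    _ = ∑ _a ∈ covering S s b, (roundLaw m β).real {ω | b ∉ (manisStep S η θ deg s ω).B} := by
        rw [Finset.sum_const, nsmul_eq_mul]
    _ ≤ ∑ a ∈ covering S s b, (roundLaw m β).real (lostEvent S η θ deg s (a, b)) :=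
        Finset.sum_le_sum fun a _ =>
          measureReal_mono fun ω hω hedge => hω (mem_edges.1 hedge).1.2

open Classical in
lemma mul_card_viable_edges_le (hη : η ≤ 1) :
    η * {e ∈ edges S s | e.1 ∈ viable S η θ deg s}.card ≤
      {e ∈ edges S s | e.1 ∈ viable S η θ deg s ∧ e.2 ∈ lowDegree S s η e.1}.card := by
  rw [Finset.natCast_card_filter, Finset.natCast_card_filter, sum_edges_eq_sum_sets,
    sum_edges_eq_sum_sets, Finset.mul_sum]
  refine Finset.sum_le_sum fun a _ => ?_
  by_cases ha : a ∈ viable S η θ deg s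
  · simp only [ha, if_true, true_and, Finset.sum_const, nsmul_eq_mul, mul_one]
    have hsub : lowDegree S s η a ⊆ S a ∩ s.B := Finset.filter_subset _ _
    rw [← Finset.natCast_card_filter, Finset.filter_mem_eq_inter, Finset.inter_eq_right.2 hsub]
    exact mul_card_le_card_filter_exceeded _ (fun b => (covering S s b).card) hη
  · simp [ha]

/-- The expected fraction of edges that a round is guaranteed to remove. -/
noncomputable def decayRate (η : ℝ) : ℝ := η / 2 * winRate η

lemma decayRate_pos (hη : 0 < η) (hη' : η ≤ 1 / 4) : 0 < decayRate η := by
  have : 0 < 1 - η / 2 := by linarith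
  unfold decayRate winRate
  positivity

lemma decayRate_lt_one (hη : 0 ≤ η) (hη' : η ≤ 1 / 4) : decayRate η < 1 := by
  have hwin : winRate η ≤ 1 := by unfold winRate; nlinarith
  unfold decayRate
  nlinarith

lemma decayRate_mul_card_edges_le (hβ : 0 < β) (hη : 0 < η) (hη' : η ≤ 1 / 4) (hθ : 0 ≤ θ) :
    decayRate η * (edges S s).card ≤
      ∑ e ∈ edges S s, (roundLaw m β).real (lostEvent S η θ deg s e) := by
  classical
  have hwin0 : 0 ≤ winRate η := by
    have : 0 ≤ 1 - η / 2 := by linarith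
    unfold winRate
    positivity
  have hwin1 : winRate η * η ≤ 1 / 2 := by
    have : winRate η ≤ 1 := by unfold winRate; nlinarith
    nlinarith
  have hsplit : ({e ∈ edges S s | e.1 ∈ viable S η θ deg s}.card : ℝ) +
      {e ∈ edges S s | e.1 ∉ viable S η θ deg s}.card = (edges S s).card := by
    exact_mod_cast Finset.card_filter_add_card_filter_not _
  have hviable := (mul_le_mul_of_nonneg_left (mul_card_viable_edges_le (S := S) (s := s) (θ := θ)
    (deg := deg) (by linarith : η ≤ 1)) hwin0).trans
    (winRate_mul_card_le_sum_lostEvent hβ hη hη' hθ)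
  have hother := half_mul_card_le_sum_lostEvent (S := S) (s := s) (η := η) (θ := θ) (deg := deg) hβ
  rw [decayRate, ← hsplit]
  nlinarith [mul_le_mul_of_nonneg_right hwin1
    (Nat.cast_nonneg (α := ℝ) {e ∈ edges S s | e.1 ∉ viable S η θ deg s}.card)]

open Classical in
lemma edges_manisStep_eq_filter (ω : RoundTape m) : edges S (manisStep S η θ deg s ω) =
    {e ∈ edges S s | ω ∈ (lostEvent S η θ deg s e)ᶜ} := by
  ext e
  simp only [Finset.mem_filter, lostEvent, Set.mem_compl_iff, Set.mem_ofPred_eq, not_not,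
    iff_and_self]
  intro he
  obtain ⟨⟨hA, hB⟩, hmem⟩ := mem_edges.1 he
  exact mem_edges.2 ⟨⟨((mem_manisStep_A S).1 hA).1, manisStep_B_subset S hB⟩, hmem⟩

lemma lintegral_card_edges_manisStep_le (hβ : 0 < β) (hη : 0 < η) (hη' : η ≤ 1 / 4) (hθ : 0 ≤ θ) :
    ∫⁻ ω, ((edges S (manisStep S η θ deg s ω)).card : ENNReal) ∂roundLaw m β ≤
      ENNReal.ofReal (1 - decayRate η) * (edges S s).card := by
  classical
  have := isProbabilityMeasure_roundLaw m hβ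
  have hkept : 0 ≤ 1 - decayRate η := by linarith [decayRate_lt_one hη.le hη']
  have hdecay := decayRate_mul_card_edges_le (S := S) (s := s) (deg := deg) hβ hη hη' hθ
  calc ∫⁻ ω, ((edges S (manisStep S η θ deg s ω)).card : ENNReal) ∂roundLaw m β
      = ∑ e ∈ edges S s, roundLaw m β (lostEvent S η θ deg s e)ᶜ := by
        simp only [edges_manisStep_eq_filter]
        exact lintegral_card_filter_mem _ _ fun e _ => (measurableSet_lostEvent e).compl
    _ = ∑ e ∈ edges S s,
          ENNReal.ofReal (1 - (roundLaw m β).real (lostEvent S η θ deg s e)) :=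
        Finset.sum_congr rfl fun e _ => by
          rw [← probReal_compl_eq_one_sub (measurableSet_lostEvent e), ofReal_measureReal]
    _ = ENNReal.ofReal
          (∑ e ∈ edges S s, (1 - (roundLaw m β).real (lostEvent S η θ deg s e))) :=
        (ENNReal.ofReal_sum_of_nonneg fun e _ => sub_nonneg.2 measureReal_le_one).symm
    _ ≤ ENNReal.ofReal ((1 - decayRate η) * (edges S s).card) := by
        refine ENNReal.ofReal_le_ofReal ?_
        rw [Finset.sum_sub_distrib, Finset.sum_const, nsmul_eq_mul, mul_one]
        linarith
    _ = ENNReal.ofReal (1 - decayRate η) * (edges S s).card := by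
        rw [ENNReal.ofReal_mul hkept, ENNReal.ofReal_natCast]

end RoundDecay

section Rounds

variable {m N R : ℕ} (S : Fin m → Finset (Fin N)) (η θ : ℝ) (deg : Fin m → ℝ) (s : ManisState m N)
  (ω : Fin R → RoundTape m)

/-- The state after the first `r` of the rounds with draws `ω`. -/
noncomputable def manisRun (r : ℕ) : ManisState m N :=
  ((List.ofFn ω).take r).foldl (manisStep S η θ deg) s

lemma manisRun_zero : manisRun S η θ deg s ω 0 = s := by simp [manisRun]

lemma manisRun_succ {r : ℕ} (hr : r < R) : manisRun S η θ deg s ω (r + 1) =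
    manisStep S η θ deg (manisRun S η θ deg s ω r) (ω ⟨r, hr⟩) := by
  simp [manisRun, List.take_add_one, List.foldl_append, hr]

lemma manisRun_update (i : Fin R) (y : RoundTape m) {r : ℕ} (hr : r ≤ i) :
    manisRun S η θ deg s (Function.update ω i y) r = manisRun S η θ deg s ω r := by
  induction r with
  | zero => simp only [manisRun_zero]
  | succ r ih =>
    have hrR : r < R := (Nat.lt_of_succ_le hr).trans i.2
    have hne : (⟨r, hrR⟩ : Fin R) ≠ i := Fin.ne_of_lt (Nat.lt_of_succ_le hr)
    rw [manisRun_succ _ _ _ _ _ _ hrR, manisRun_succ _ _ _ _ _ _ hrR,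
      ih (Nat.le_of_succ_le hr), Function.update_of_ne hne]

lemma measurable_manisRun {Z : Type*} [MeasurableSpace Z] {deg : Z → Fin m → ℝ}
    {s : Z → ManisState m N} {ω : Z → Fin R → RoundTape m} (hdeg : ∀ a, Measurable fun z => deg z a)
    (hs : Measurable s) (hω : Measurable ω) {r : ℕ} (hr : r ≤ R) :
    Measurable fun z => manisRun S η θ (deg z) (s z) (ω z) r := by
  induction r with
  | zero => simpa only [manisRun_zero] using hs
  | succ r ih =>
    have hround : Measurable fun z => ω z ⟨r, hr⟩ := (measurable_pi_apply _).comp hω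
    simp only [manisRun_succ _ _ _ _ _ _ (Nat.lt_of_succ_le hr)]
    exact measurable_manisStep S η θ hdeg (ih (Nat.le_of_succ_le hr)) (measurable_pi_iff.1 hround)

variable {S η θ deg s} {β : ℝ}

lemma lintegral_card_edges_manisRun_le (hβ : 0 < β) (hη : 0 < η) (hη' : η ≤ 1 / 4) (hθ : 0 ≤ θ)
    {r : ℕ} (hr : r ≤ R) :
    ∫⁻ ω, ((edges S (manisRun S η θ deg s ω r)).card : ENNReal)
        ∂(Measure.pi fun _ : Fin R => roundLaw m β) ≤
      ENNReal.ofReal (1 - decayRate η) ^ r * (edges S s).card := by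
  have := isProbabilityMeasure_roundLaw m hβ
  have hcard : Measurable fun t : ManisState m N => ((edges S t).card : ENNReal) :=
    Measurable.of_discrete
  induction r with
  | zero => simp [manisRun_zero]
  | succ r ih =>
    have hrun : Measurable fun ω : Fin R → RoundTape m => manisRun S η θ deg s ω r :=
      measurable_manisRun S η θ (deg := fun _ => deg) (s := fun _ => s)
        (fun _ => measurable_const) measurable_const measurable_id
        (Nat.le_of_succ_le hr)
    have hstep : Measurable fun p : ManisState m N × RoundTape m =>
        manisStep S η θ deg p.1 p.2 :=
      measurable_manisStep S η θ (fun _ => measurable_const) measurable_fst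
        (measurable_pi_iff.1 measurable_snd)
    simp only [manisRun_succ _ _ _ _ _ _ (Nat.lt_of_succ_le hr)]
    calc ∫⁻ ω, ((edges S (manisStep S η θ deg (manisRun S η θ deg s ω r)
            (ω ⟨r, hr⟩))).card : ENNReal) ∂(Measure.pi fun _ : Fin R => roundLaw m β)
        = ∫⁻ ω, ∫⁻ y, ((edges S (manisStep S η θ deg (manisRun S η θ deg s ω r) y)).card : ENNReal)
            ∂roundLaw m β ∂(Measure.pi fun _ : Fin R => roundLaw m β) :=
          lintegral_pi_eq_lintegral_lintegral (fun _ : Fin R => roundLaw m β) ⟨r, hr⟩ hrun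
            (g := fun p => ((edges S (manisStep S η θ deg p.1 p.2)).card : ENNReal))
            (fun ω y => manisRun_update S η θ deg s ω ⟨r, hr⟩ y le_rfl) (hcard.comp hstep)
      _ ≤ ∫⁻ ω, ENNReal.ofReal (1 - decayRate η) * (edges S (manisRun S η θ deg s ω r)).card
            ∂(Measure.pi fun _ : Fin R => roundLaw m β) :=
          lintegral_mono fun ω => lintegral_card_edges_manisStep_le hβ hη hη' hθ
      _ = ENNReal.ofReal (1 - decayRate η) *
            ∫⁻ ω, (edges S (manisRun S η θ deg s ω r)).card
              ∂(Measure.pi fun _ : Fin R => roundLaw m β) :=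
          lintegral_const_mul _ (hcard.comp hrun)
      _ ≤ ENNReal.ofReal (1 - decayRate η) ^ (r + 1) * (edges S s).card := by
          rw [pow_succ', mul_assoc]
          exact mul_le_mul_right (ih (Nat.le_of_succ_le hr)) _

lemma card_edges_le : (edges S s).card ≤ m * N :=
  calc (edges S s).card ≤ (s.A ×ˢ s.B).card := Finset.card_filter_le _ _
    _ ≤ m * N := by
      rw [Finset.card_product]
      exact Nat.mul_le_mul (card_finset_fin_le _) (card_finset_fin_le _)

lemma measure_edges_manisRun_nonempty_le (hβ : 0 < β) (hη : 0 < η) (hη' : η ≤ 1 / 4)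
    (hθ : 0 ≤ θ) :
    (Measure.pi fun _ : Fin R => roundLaw m β)
      {ω | (edges S (manisRun S η θ deg s ω R)).Nonempty} ≤
      ENNReal.ofReal (1 - decayRate η) ^ R * (m * N : ℕ) := by
  have hcard : Measurable fun ω : Fin R → RoundTape m =>
      ((edges S (manisRun S η θ deg s ω R)).card : ENNReal) :=
    (Measurable.of_discrete (f := fun t : ManisState m N => ((edges S t).card : ENNReal))).comp
      (measurable_manisRun S η θ (deg := fun _ => deg) (s := fun _ => s)
        (fun _ => measurable_const) measurable_const measurable_id le_rfl)
  calc (Measure.pi fun _ : Fin R => roundLaw m β)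
        {ω | (edges S (manisRun S η θ deg s ω R)).Nonempty}
      ≤ (Measure.pi fun _ : Fin R => roundLaw m β)
          {ω | 1 ≤ ((edges S (manisRun S η θ deg s ω R)).card : ENNReal)} :=
        measure_mono fun ω (hω : (edges S (manisRun S η θ deg s ω R)).Nonempty) =>
          show (1 : ENNReal) ≤ _ from Nat.one_le_cast.2 hω.card_pos
    _ ≤ ∫⁻ ω, ((edges S (manisRun S η θ deg s ω R)).card : ENNReal)
          ∂(Measure.pi fun _ : Fin R => roundLaw m β) := by
        simpa only [one_mul] using mul_meas_ge_le_lintegral hcard 1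
    _ ≤ ENNReal.ofReal (1 - decayRate η) ^ R * (edges S s).card :=
        lintegral_card_edges_manisRun_le hβ hη hη' hθ le_rfl
    _ ≤ ENNReal.ofReal (1 - decayRate η) ^ R * (m * N : ℕ) :=
        mul_le_mul_right (Nat.cast_le.2 card_edges_le) _

end Rounds

/-! ### Deterministic guarantees of one call -/

/-- `Q` holds for every entry of `l` together with the list of the entries preceding it. -/
def ForallPrefix {α : Type*} (Q : List α → α → Prop) (l : List α) : Prop :=
  ∀ P a T, l = P ++ a :: T → Q P a

lemma forallPrefix_nil {α : Type*} (Q : List α → α → Prop) : ForallPrefix Q [] :=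
  fun P a T h => by simp at h

lemma ForallPrefix.append {α : Type*} {Q : List α → α → Prop} {l₁ l₂ : List α}
    (h₁ : ForallPrefix Q l₁) (h₂ : ForallPrefix (fun P a => Q (l₁ ++ P) a) l₂) :
    ForallPrefix Q (l₁ ++ l₂) := by
  intro P a T h
  rcases List.append_eq_append_iff.1 h with ⟨as, rfl, h'⟩ | ⟨bs, rfl, h'⟩
  · exact h₂ as a T h'
  · cases bs with
    | nil => simpa using h₂ [] a T (by simpa using h'.symm)
    | cons b bs =>
      rw [List.cons_append, List.cons.injEq] at h'
      exact h₁ P a bs (by rw [h'.1])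

section Sorting

variable {m : ℕ} {x : Fin m → ℝ} {J : Finset (Fin m)}

lemma mem_sortByPriority {a : Fin m} : a ∈ sortByPriority x J ↔ a ∈ J := by
  simp [sortByPriority]

lemma nodup_sortByPriority : (sortByPriority x J).Nodup :=
  (List.perm_insertionSort _ _).nodup_iff.2 ((List.nodup_finRange m).filter _)

lemma pairwise_sortByPriority (hx : Function.Injective x) :
    (sortByPriority x J).Pairwise fun a a' => x a' < x a := by
  classical
  have : Std.Total fun a a' : Fin m => x a' ≤ x a := ⟨fun _ _ => le_total _ _⟩
  have : IsTrans (Fin m) fun a a' : Fin m => x a' ≤ x a := ⟨fun _ _ _ h h' => h'.trans h⟩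
  have hle : (sortByPriority x J).Pairwise fun a a' => x a' ≤ x a :=
    List.pairwise_insertionSort _ _
  exact hle.imp₂ (fun _ _ h hne => h.lt_of_ne fun heq => hne (hx heq).symm) nodup_sortByPriority

end Sorting

section Call

variable {m N R : ℕ} {S : Fin m → Finset (Fin N)} {η θ z : ℝ} {deg : Fin m → ℝ}
  {A₀ : Finset (Fin m)} {B₀ : Finset (Fin N)} {s : ManisState m N} {ω : RoundTape m} {a : Fin m}

variable (S A₀ B₀ s) in
/-- The bookkeeping invariant of a call on the sets `A₀` and the elements `B₀`. -/
structure ManisInvariant : Prop where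
  nodup : s.out.Nodup
  out_subset : s.out.toFinset ⊆ A₀
  A_subset : s.A ⊆ A₀
  disjoint : Disjoint s.out.toFinset s.A
  B_eq : s.B = B₀ \ s.out.toFinset.biUnion S

lemma manisInvariant_start : ManisInvariant S A₀ B₀ ⟨A₀, B₀, []⟩ :=
  ⟨by simp, by simp, subset_rfl, by simp, by simp⟩

lemma toFinset_out_manisStep : (manisStep S η θ deg s ω).out.toFinset =
    s.out.toFinset ∪ selected S η deg s ω := by
  ext a
  simp [manisStep_out, mem_sortByPriority]

lemma selected_subset : selected S η deg s ω ⊆ s.A := Finset.filter_subset _ _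

lemma ManisInvariant.manisStep (h : ManisInvariant S A₀ B₀ s) :
    ManisInvariant S A₀ B₀ (manisStep S η θ deg s ω) where
  nodup := by
    rw [manisStep_out]
    refine h.nodup.append nodup_sortByPriority fun a ha ha' => ?_
    exact Finset.disjoint_left.1 h.disjoint (List.mem_toFinset.2 ha)
      (selected_subset (mem_sortByPriority.1 ha'))
  out_subset := by
    rw [toFinset_out_manisStep]
    exact Finset.union_subset h.out_subset (selected_subset.trans h.A_subset)
  A_subset := fun a ha => h.A_subset ((mem_manisStep_A S).1 ha).1
  disjoint := by
    rw [toFinset_out_manisStep]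
    refine Finset.disjoint_left.2 fun a ha ha' => ?_
    obtain ⟨haA, haJ, -⟩ := (mem_manisStep_A S).1 ha'
    rcases Finset.mem_union.1 ha with hout | hJ
    · exact Finset.disjoint_left.1 h.disjoint hout haA
    · exact haJ hJ
  B_eq := by
    rw [manisStep_B, toFinset_out_manisStep, h.B_eq, Finset.union_biUnion, sdiff_sdiff_left,
      Finset.sup_eq_union]

lemma manisInvariant_manisRun {ω : Fin R → RoundTape m} {r : ℕ} (hr : r ≤ R) :
    ManisInvariant S A₀ B₀ (manisRun S η θ deg ⟨A₀, B₀, []⟩ ω r) := by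
  induction r with
  | zero => exact manisRun_zero S η θ deg _ ω ▸ manisInvariant_start
  | succ r ih =>
    rw [manisRun_succ _ _ _ _ _ _ (Nat.lt_of_succ_le hr)]
    exact (ih (Nat.le_of_succ_le hr)).manisStep

variable (z ω) in
/-- The draws `ω` of a round have noise at most `z` and distinct priorities. -/
structure TameRound : Prop where
  selection_le : ∀ a, |(ω a).2.1| ≤ z
  survival_le : ∀ a, |(ω a).2.2| ≤ z
  injective : Function.Injective fun a => (ω a).1

lemma picks_subset_sdiff_biUnion (h : ManisInvariant S A₀ B₀ s)
    (hinj : Function.Injective fun a => (ω a).1) {P T : List (Fin m)}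
    (hsplit : sortByPriority (fun a => (ω a).1) (selected S η deg s ω) = P ++ a :: T) :
    picks S s.A s.B (fun a => (ω a).1) a ⊆
      (S a ∩ B₀) \ (s.out ++ P).toFinset.biUnion S := by
  have hlt : ∀ p ∈ P, (ω a).1 < (ω p).1 := fun p hp =>
    (List.pairwise_append.1 (hsplit ▸ pairwise_sortByPriority hinj)).2.2 p hp a List.mem_cons_self
  have hmem : ∀ p ∈ P, p ∈ s.A := fun p hp =>
    selected_subset (mem_sortByPriority.1 (hsplit ▸ List.mem_append_left _ hp))
  intro b hb
  obtain ⟨hbB, hba, hmax⟩ := Finset.mem_filter.1 hb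
  rw [h.B_eq, Finset.mem_sdiff] at hbB
  simp only [Finset.mem_sdiff, Finset.mem_inter, List.toFinset_append, Finset.union_biUnion,
    Finset.mem_union, not_or]
  refine ⟨⟨hba, hbB.1⟩, hbB.2, fun hbP => ?_⟩
  obtain ⟨p, hp, hbp⟩ := Finset.mem_biUnion.1 hbP
  exact (hmax p (hmem p (List.mem_toFinset.1 hp)) hbp).not_gt (hlt p (List.mem_toFinset.1 hp))

lemma forallPrefix_out_manisStep (hη : 0 ≤ η) (hη' : η ≤ 1 / 4)
    (h : ManisInvariant S A₀ B₀ s) (hdeg : ∀ a, |deg a - (S a ∩ B₀).card| ≤ z)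
    (hω : TameRound z ω)
    (hout : ForallPrefix (fun P a => (1 - 4 * η) * (S a ∩ B₀).card - 2 * z ≤
      ((S a ∩ B₀) \ P.toFinset.biUnion S).card) s.out) :
    ForallPrefix (fun P a => (1 - 4 * η) * (S a ∩ B₀).card - 2 * z ≤
      ((S a ∩ B₀) \ P.toFinset.biUnion S).card) (manisStep S η θ deg s ω).out := by
  rw [manisStep_out]
  refine hout.append fun P a T hsplit => ?_
  have hselected := ((mem_selected S).1 (mem_sortByPriority.1
    (hsplit ▸ List.mem_append_right P (List.mem_cons_self (l := T))))).2
  have hpicks : ((picks S s.A s.B (fun a => (ω a).1) a).card : ℝ) ≤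
      ((S a ∩ B₀) \ (s.out ++ P).toFinset.biUnion S).card :=
    Nat.cast_le.2 (Finset.card_le_card (picks_subset_sdiff_biUnion h hω.injective hsplit))
  have hdeg_a := abs_le.1 (hdeg a)
  have hnoise := abs_le.1 (hω.selection_le a)
  nlinarith

lemma card_inter_manisStep_B_le (hη : 0 ≤ η) (hη' : η ≤ 1) (hθ : θ ≤ z)
    (hdeg : |deg a - (S a ∩ B₀).card| ≤ z) (hω : TameRound z ω) (ha : a ∈ s.A)
    (hout : a ∉ selected S η deg s ω) (hA : a ∉ (manisStep S η θ deg s ω).A) :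
    ((S a ∩ (manisStep S η θ deg s ω).B).card : ℝ) ≤ (1 - η) * (S a ∩ B₀).card + 3 * z := by
  have hfailed := not_le.1 fun hle => hA ((mem_manisStep_A S).2 ⟨ha, hout, hle⟩)
  have hdeg_a := abs_le.1 hdeg
  have hnoise := abs_le.1 (hω.survival_le a)
  nlinarith

section Run

variable {ω : Fin R → RoundTape m}

lemma forallPrefix_out_manisRun (hη : 0 ≤ η) (hη' : η ≤ 1 / 4)
    (hdeg : ∀ a, |deg a - (S a ∩ B₀).card| ≤ z) (hω : ∀ r, TameRound z (ω r)) {r : ℕ}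
    (hr : r ≤ R) :
    ForallPrefix (fun P a => (1 - 4 * η) * (S a ∩ B₀).card - 2 * z ≤
      ((S a ∩ B₀) \ P.toFinset.biUnion S).card)
      (manisRun S η θ deg ⟨A₀, B₀, []⟩ ω r).out := by
  induction r with
  | zero => exact manisRun_zero S η θ deg _ ω ▸ forallPrefix_nil _
  | succ r ih =>
    rw [manisRun_succ _ _ _ _ _ _ (Nat.lt_of_succ_le hr)]
    exact forallPrefix_out_manisStep hη hη' (manisInvariant_manisRun (Nat.le_of_succ_le hr)) hdeg
      (hω _) (ih (Nat.le_of_succ_le hr))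

lemma card_inter_manisRun_B_le (hη : 0 ≤ η) (hη' : η ≤ 1) (hθ : θ ≤ z)
    (hdeg : |deg a - (S a ∩ B₀).card| ≤ z) (hω : ∀ r, TameRound z (ω r)) (ha : a ∈ A₀) {r : ℕ}
    (hr : r ≤ R) (hout : a ∉ (manisRun S η θ deg ⟨A₀, B₀, []⟩ ω r).out)
    (hA : a ∉ (manisRun S η θ deg ⟨A₀, B₀, []⟩ ω r).A) :
    ((S a ∩ (manisRun S η θ deg ⟨A₀, B₀, []⟩ ω r).B).card : ℝ) ≤
      (1 - η) * (S a ∩ B₀).card + 3 * z := by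
  induction r with
  | zero =>
    rw [manisRun_zero] at hA
    exact absurd ha hA
  | succ r ih =>
    rw [manisRun_succ _ _ _ _ _ _ (Nat.lt_of_succ_le hr)] at hout hA ⊢
    set s := manisRun S η θ deg ⟨A₀, B₀, []⟩ ω r
    rw [← List.mem_toFinset, toFinset_out_manisStep, Finset.mem_union, not_or,
      List.mem_toFinset] at hout
    by_cases has : a ∈ s.A
    · exact card_inter_manisStep_B_le hη hη' hθ hdeg (hω _) has hout.2 hA
    · refine le_trans ?_ (ih (Nat.le_of_succ_le hr) hout.1 has)
      exact Nat.cast_le.2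
        (Finset.card_le_card (Finset.inter_subset_inter_left (manisStep_B_subset S)))

end Run

end Call

/-! ### Deterministic guarantees of the phases -/

section Phases

variable {m N R T : ℕ} (S : Fin m → Finset (Fin N)) (η θ κ : ℝ) (t : ℕ)
  (ω : (Fin m → ℝ) × ManisTape m R) (s : CoverState m N)

open Classical in
/-- The sets `𝒜_{t+1}` on which phase `t + 1` calls the nearly independent set procedure; `κ` is
the slack `K log² n / ε₀` on both sides. -/
noncomputable def bucket (ν : Fin m → ℝ) : Finset (Fin m) :=
  {a ∈ s.rem | 1 / (1 - η) ^ t - κ ≤ (S a ∩ s.U).card + ν a ∧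
    (S a ∩ s.U).card + ν a ≤ 1 / (1 - η) ^ (t + 1) + κ}

/-- The final state of the call made in phase `t + 1`; `θ` is the offset of its survival tests. -/
noncomputable def phaseCall : ManisState m N :=
  manisRun S η θ (fun a => (S a ∩ s.U).card + ω.2.1 a) ⟨bucket S η κ t s ω.1, s.U, []⟩ ω.2.2 R

/-- Phase `t + 1`, which leads from `(𝒰_{t+1}, 𝒮_{t+1})` to `(𝒰_t, 𝒮_t)`, in terms of the offset
`θ` and the slack `κ` alone. -/
noncomputable def phase : CoverState m N where
  U := s.U \ (phaseCall S η θ κ t ω s).out.toFinset.biUnion S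
  rem := s.rem \ (phaseCall S η θ κ t ω s).out.toFinset
  out := s.out ++ (phaseCall S η θ κ t ω s).out

/-- The bookkeeping invariant of the algorithm. -/
structure CoverInvariant : Prop where
  nodup : s.out.Nodup
  rem_eq : s.rem = s.out.toFinsetᶜ
  U_eq : s.U = (s.out.toFinset.biUnion S)ᶜ

/-- The entry `a` covers, after the sets in `P`, at least `1 - 5η` times as many new elements as
any set does, up to `v`. -/
def NearGreedy (v : ℝ) (P : List (Fin m)) (a : Fin m) : Prop :=
  ∀ g, (1 - 5 * η) * newCoverage S P g - v ≤ newCoverage S P a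

variable {S η θ κ t ω s} {z w v : ℝ} {a : Fin m}

lemma manisInvariant_phaseCall :
    ManisInvariant S (bucket S η κ t s ω.1) s.U (phaseCall S η θ κ t ω s) :=
  manisInvariant_manisRun le_rfl

lemma mem_rem_of_mem_bucket {ν : Fin m → ℝ} (ha : a ∈ bucket S η κ t s ν) : a ∈ s.rem :=
  (Finset.mem_filter.1 ha).1

lemma CoverInvariant.mem_rem (h : CoverInvariant S s) : a ∈ s.rem ↔ a ∉ s.out := by
  rw [h.rem_eq, Finset.mem_compl, List.mem_toFinset]

lemma coverInvariant_start : CoverInvariant S ⟨Finset.univ, Finset.univ, []⟩ :=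
  ⟨by simp, by simp, by simp⟩

lemma CoverInvariant.phase (h : CoverInvariant S s) : CoverInvariant S (phase S η θ κ t ω s) where
  nodup := h.nodup.append manisInvariant_phaseCall.nodup fun _ ha ha' =>
    h.mem_rem.1 (mem_rem_of_mem_bucket
      (manisInvariant_phaseCall.out_subset (List.mem_toFinset.2 ha'))) ha
  rem_eq := by
    simp only [DPCover.phase, h.rem_eq, List.toFinset_append, Finset.compl_union,
      Finset.sdiff_eq_inter_compl]
  U_eq := by
    simp only [DPCover.phase, h.U_eq, List.toFinset_append, Finset.union_biUnion,
      Finset.compl_union, Finset.sdiff_eq_inter_compl]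

lemma CoverInvariant.newCoverage_append (h : CoverInvariant S s) (P : List (Fin m)) (a : Fin m) :
    newCoverage S (s.out ++ P) a = ((S a ∩ s.U) \ P.toFinset.biUnion S).card := by
  rw [newCoverage, h.U_eq, List.toFinset_append, Finset.union_biUnion,
    ← Finset.sdiff_eq_inter_compl, sdiff_sdiff_left, Finset.sup_eq_union]

lemma CoverInvariant.newCoverage_append_le (h : CoverInvariant S s) {x : ℝ} (hx : 0 ≤ x)
    (hle : ∀ a ∈ s.rem, ((S a ∩ s.U).card : ℝ) ≤ x) (P : List (Fin m)) (g : Fin m) :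
    (newCoverage S (s.out ++ P) g : ℝ) ≤ x := by
  rw [h.newCoverage_append]
  by_cases hg : g ∈ s.rem
  · exact (Nat.cast_le.2 (Finset.card_le_card Finset.sdiff_subset)).trans (hle g hg)
  · have hcovered : S g ∩ s.U = ∅ := by
      rw [h.U_eq, ← Finset.sdiff_eq_inter_compl, Finset.sdiff_eq_empty_iff_subset]
      exact Finset.subset_biUnion_of_mem S (List.mem_toFinset.2 (not_not.1 (hg ∘ h.mem_rem.2)))
    simpa [hcovered] using hx

/-- The draws `ω` of a phase have noise at most `z` and, in each round, distinct priorities. -/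
structure TamePhase (z : ℝ) (ω : (Fin m → ℝ) × ManisTape m R) : Prop where
  bucket_le : ∀ a, |ω.1 a| ≤ z
  degree_le : ∀ a, |ω.2.1 a| ≤ z
  rounds : ∀ r, TameRound z (ω.2.2 r)

lemma one_div_one_sub_pow_eq (hη : η < 1) (t : ℕ) :
    1 / (1 - η) ^ t = (1 - η) * (1 / (1 - η) ^ (t + 1)) := by
  have : 1 - η ≠ 0 := by linarith
  rw [pow_succ']
  field_simp

lemma forallPrefix_nearGreedy_phase (h : CoverInvariant S s) (hη : 0 ≤ η) (hη' : η ≤ 1 / 5)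
    (hω : TamePhase z ω) (hw : 0 ≤ w) (hκ : 0 ≤ κ) (hv : w + κ + 3 * z ≤ v)
    (hle : ∀ a ∈ s.rem, ((S a ∩ s.U).card : ℝ) ≤ 1 / (1 - η) ^ (t + 1) + w)
    (hout : ForallPrefix (NearGreedy S η v) s.out) :
    ForallPrefix (NearGreedy S η v) (phase S η θ κ t ω s).out := by
  refine hout.append fun P a Q hsplit g => ?_
  have hz : 0 ≤ z := (abs_nonneg _).trans (hω.bucket_le a)
  have hη1 : 0 < 1 - η := by linarith
  have hnew := forallPrefix_out_manisRun hη (by linarith)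
    (fun a => by simpa using hω.degree_le a) hω.rounds le_rfl P a Q hsplit
  have hbucket : a ∈ bucket S η κ t s ω.1 :=
    manisInvariant_phaseCall.out_subset (List.mem_toFinset.2 (by rw [hsplit]; simp))
  have hlarge := (Finset.mem_filter.1 hbucket).2.1
  have hnoise := abs_le.1 (hω.bucket_le a)
  have hgreedy := h.newCoverage_append_le (by positivity) hle P g
  rw [one_div_one_sub_pow_eq (by linarith)] at hlarge
  rw [h.newCoverage_append P a]
  set q := 1 / (1 - η) ^ (t + 1)
  have hq : 0 ≤ q := by positivity
  calc (1 - 5 * η) * (newCoverage S (s.out ++ P) g : ℝ) - v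
      ≤ (1 - 5 * η) * (q + w) - (w + κ + 3 * z) := by gcongr; linarith
    _ ≤ (1 - 4 * η) * ((1 - η) * q - κ - z) - 2 * z := by
        nlinarith [mul_nonneg hη hw, mul_nonneg hη hκ, mul_nonneg hη hz,
          mul_nonneg (mul_nonneg hη hη) hq]
    _ ≤ (1 - 4 * η) * (S a ∩ s.U).card - 2 * z := by
        gcongr
        · linarith
        · linarith
    _ ≤ ((S a ∩ s.U) \ P.toFinset.biUnion S).card := hnew

lemma inter_B_eq_empty_of_edges_eq_empty {s : ManisState m N} (h : edges S s = ∅) (ha : a ∈ s.A) :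
    S a ∩ s.B = ∅ :=
  Finset.eq_empty_of_forall_notMem fun b hb =>
    have ⟨hba, hbB⟩ := Finset.mem_inter.1 hb
    Finset.eq_empty_iff_forall_notMem.1 h (a, b) (mem_edges.2 ⟨⟨ha, hbB⟩, hba⟩)

lemma card_inter_phase_U_le (hη : 0 ≤ η) (hη' : η ≤ 1) (hω : TamePhase z ω) (hθ : θ ≤ z)
    (hκ : w + z ≤ κ) (hw : 0 ≤ w)
    (hle : ∀ a ∈ s.rem, ((S a ∩ s.U).card : ℝ) ≤ 1 / (1 - η) ^ (t + 1) + w)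
    (hdone : edges S (phaseCall S η θ κ t ω s) = ∅) (ha : a ∈ (phase S η θ κ t ω s).rem)
    (hlarge : 1 / (1 - η) ^ t ≤ (S a ∩ s.U).card) :
    ((S a ∩ (phase S η θ κ t ω s).U).card : ℝ) ≤ (1 - η) * (S a ∩ s.U).card + 3 * z := by
  obtain ⟨harem, haout⟩ := Finset.mem_sdiff.1 ha
  have hz : 0 ≤ z := (abs_nonneg _).trans (hω.bucket_le a)
  have hbucket : a ∈ bucket S η κ t s ω.1 := by
    have hnoise := abs_le.1 (hω.bucket_le a)
    exact Finset.mem_filter.2 ⟨harem, by linarith, by linarith [hle a harem]⟩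
  rw [phase, ← manisInvariant_phaseCall.B_eq]
  by_cases haA : a ∈ (phaseCall S η θ κ t ω s).A
  · rw [inter_B_eq_empty_of_edges_eq_empty hdone haA, Finset.card_empty, Nat.cast_zero]
    have : 0 ≤ 1 - η := by linarith
    positivity
  · exact card_inter_manisRun_B_le hη hη' hθ (by simpa using hω.degree_le a) hω.rounds hbucket
      le_rfl (fun hmem => haout (List.mem_toFinset.2 hmem)) haA

lemma card_inter_phase_U_le_card : (S a ∩ (phase S η θ κ t ω s).U).card ≤ (S a ∩ s.U).card :=
  Finset.card_le_card (Finset.inter_subset_inter_left Finset.sdiff_subset)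

lemma card_inter_phase_U_le_pow (hη : 0 ≤ η) (hη' : η < 1) (hω : TamePhase z ω) (hθ : θ ≤ z)
    (hw : 0 ≤ w) (hzw : 3 * z ≤ η * w) (hκ : w + z ≤ κ)
    (hle : ∀ a ∈ s.rem, ((S a ∩ s.U).card : ℝ) ≤ 1 / (1 - η) ^ (t + 1) + w)
    (hdone : edges S (phaseCall S η θ κ t ω s) = ∅) :
    ∀ a ∈ (phase S η θ κ t ω s).rem,
      ((S a ∩ (phase S η θ κ t ω s).U).card : ℝ) ≤ 1 / (1 - η) ^ t + w := by
  intro a ha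
  rcases le_or_gt (1 / (1 - η) ^ t) ((S a ∩ s.U).card : ℝ) with hlarge | hsmall
  · calc ((S a ∩ (phase S η θ κ t ω s).U).card : ℝ)
        ≤ (1 - η) * (S a ∩ s.U).card + 3 * z :=
          card_inter_phase_U_le hη hη'.le hω hθ hκ hw hle hdone ha hlarge
      _ ≤ (1 - η) * (1 / (1 - η) ^ (t + 1) + w) + η * w := by
          gcongr
          exact hle a (Finset.mem_sdiff.1 ha).1
      _ = 1 / (1 - η) ^ t + w := by
          rw [one_div_one_sub_pow_eq hη' t]
          ring
  · exact (Nat.cast_le.2 card_inter_phase_U_le_card).trans (by linarith)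

lemma card_inter_phase_zero_U_le (hη : 0 < η) (hη' : η < 1 / 5) (hω : TamePhase z ω) (hθ : θ ≤ z)
    (hw : 0 ≤ w) (hzw : 3 * z ≤ η * w) (hκ : w + z ≤ κ)
    (hle : ∀ a ∈ s.rem, ((S a ∩ s.U).card : ℝ) ≤ 1 / (1 - η) ^ (0 + 1) + w)
    (hdone : edges S (phaseCall S η θ κ 0 ω s) = ∅) :
    ∀ a ∈ (phase S η θ κ 0 ω s).rem, ((S a ∩ (phase S η θ κ 0 ω s).U).card : ℝ) ≤ 5 * w := by
  intro a ha
  rcases lt_or_ge w (1 / 4) with hw4 | hw4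
  · -- Coverage is an integer, so with so little slack nothing is left at all.
    suffices hcard : (S a ∩ (phase S η θ κ 0 ω s).U).card = 0 by
      rw [hcard, Nat.cast_zero]
      positivity
    rcases Nat.eq_zero_or_pos (S a ∩ s.U).card with hzero | hpos
    · exact Nat.le_zero.1 (hzero ▸ card_inter_phase_U_le_card)
    have hpow : 1 / (1 - η) ^ (0 + 1) < 5 / 4 := by
      rw [zero_add, pow_one, div_lt_iff₀ (by linarith)]
      linarith
    have hlt_two : ((S a ∩ s.U).card : ℝ) < (2 : ℕ) := by
      have := hle a (Finset.mem_sdiff.1 ha).1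
      push_cast
      linarith
    have hone : ((S a ∩ s.U).card : ℝ) = 1 := by
      rw [le_antisymm (Nat.lt_succ_iff.1 (Nat.cast_lt.1 hlt_two)) hpos, Nat.cast_one]
    have hshrinks := card_inter_phase_U_le hη.le (by linarith) hω hθ hκ hw hle hdone ha
      (by rw [hone, pow_zero, div_one])
    rw [hone] at hshrinks
    exact Nat.cast_lt_one.1 (by nlinarith : ((S a ∩ (phase S η θ κ 0 ω s).U).card : ℝ) < 1)
  · have := card_inter_phase_U_le_pow hη.le (by linarith) hω hθ hw hzw hκ hle hdone a ha
    rw [pow_zero, div_one] at this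
    linarith

end Phases

section Run

variable {m N R T : ℕ} (S : Fin m → Finset (Fin N)) (η θ κ : ℝ) (ω : CoverTape m T R)

/-- The state `(𝒰_t, 𝒮_t)` reached when the phases `T, …, t + 1` have been run. -/
noncomputable def coverRun (t : ℕ) : CoverState m N :=
  ((List.finRange T).reverse.take (T - t)).foldl
    (fun s (i : Fin T) => phase S η θ κ i (ω i) s) ⟨Finset.univ, Finset.univ, []⟩

lemma coverRun_self : coverRun S η θ κ ω T = ⟨Finset.univ, Finset.univ, []⟩ := by
  simp [coverRun]

lemma coverRun_eq_phase {t : ℕ} (ht : t < T) :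
    coverRun S η θ κ ω t = phase S η θ κ t (ω ⟨t, ht⟩) (coverRun S η θ κ ω (t + 1)) := by
  have hget : (List.finRange T).reverse[T - (t + 1)]? = some ⟨t, ht⟩ := by
    rw [List.finRange_reverse, List.getElem?_map, List.getElem?_eq_getElem (by simp; omega)]
    simp only [List.getElem_finRange, Option.map_some, Option.some.injEq, Fin.ext_iff, Fin.rev,
      Fin.val_cast]
    omega
  simp only [coverRun, show T - t = T - (t + 1) + 1 by omega, List.take_add_one, hget,
    Option.toList_some, List.foldl_append, List.foldl_cons, List.foldl_nil]

/-- The offset of the survival tests in the calls made by the algorithm. -/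
noncomputable def survivalOffset (n : ℕ) (η C₁ ε : ℝ) : ℝ :=
  6 * Real.log n / ((1 - 3 * η) * manisEps n C₁ (eps0 n η ε))

/-- The slack of the bucket tests made by the algorithm. -/
noncomputable def bucketSlack (n : ℕ) (η K ε : ℝ) : ℝ := K * Real.log n ^ 2 / eps0 n η ε

lemma coverStep_eq_phase (n : ℕ) (C₁ K ε : ℝ) (t : ℕ) (ω : (Fin m → ℝ) × ManisTape m R)
    (s : CoverState m N) : coverStep S n η C₁ K ε (t + 1) ω s =
      phase S η (survivalOffset n η C₁ ε) (bucketSlack n η K ε) t ω s := by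
  have hcall : manis S n η C₁ (eps0 n η ε) (bucket S η (bucketSlack n η K ε) t s ω.1) s.U ω.2 =
      (phaseCall S η (survivalOffset n η C₁ ε) (bucketSlack n η K ε) t ω s).out := by
    rw [phaseCall, manisRun, List.take_of_length_le (List.length_ofFn (f := ω.2.2)).le]
    rfl
  rw [phase, ← hcall]
  rfl

lemma coverOutput_eq (n : ℕ) (C₁ K ε : ℝ) : coverOutput S n η C₁ K ε ω =
    (coverRun S η (survivalOffset n η C₁ ε) (bucketSlack n η K ε) ω 0).out ++
      (List.finRange m).filter fun a =>
        a ∈ (coverRun S η (survivalOffset n η C₁ ε) (bucketSlack n η K ε) ω 0).rem := by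
  rw [coverRun, Nat.sub_zero, List.take_of_length_le (by simp)]
  simp only [coverOutput, coverStep_eq_phase]

variable {S η θ κ ω} {z w v : ℝ}

lemma coverInvariant_coverRun {t : ℕ} (ht : t ≤ T) :
    CoverInvariant S (coverRun S η θ κ ω t) := by
  induction ht using Nat.decreasingInduction with
  | self => exact coverRun_self S η θ κ ω ▸ coverInvariant_start
  | of_succ t ht ih => exact coverRun_eq_phase S η θ κ ω ht ▸ ih.phase

lemma CoverInvariant.out_append_perm {s : CoverState m N} (h : CoverInvariant S s) :
    (s.out ++ (List.finRange m).filter fun a => a ∈ s.rem).Perm (List.finRange m) := by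
  refine (List.perm_ext_iff_of_nodup ?_ (List.nodup_finRange m)).2 fun a => ?_
  · refine h.nodup.append ((List.nodup_finRange m).filter _) fun a hout hrem => ?_
    exact h.mem_rem.1 (of_decide_eq_true (List.mem_filter.1 hrem).2) hout
  · simp [h.mem_rem, em]

lemma coverOutput_perm (n : ℕ) (C₁ K ε : ℝ) :
    (coverOutput S n η C₁ K ε ω).Perm (List.finRange m) :=
  coverOutput_eq S η ω n C₁ K ε ▸ (coverInvariant_coverRun T.zero_le).out_append_perm

variable (S η θ κ ω z) in
/-- All phases behave well: their draws are tame and their calls run out of edges. -/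
structure GoodDraws : Prop where
  tame : ∀ i, TamePhase z (ω i)
  exhausted : ∀ i : Fin T,
    edges S (phaseCall S η θ κ i (ω i) (coverRun S η θ κ ω (i + 1))) = ∅

lemma card_inter_coverRun_U_le (hη : 0 ≤ η) (hη' : η < 1) (hω : GoodDraws S η θ κ ω z)
    (hθ : θ ≤ z) (hw : 0 ≤ w) (hzw : 3 * z ≤ η * w) (hκ : w + z ≤ κ)
    (hT : N ≤ 1 / (1 - η) ^ T) {t : ℕ} (ht : t ≤ T) :
    ∀ a ∈ (coverRun S η θ κ ω t).rem,
      ((S a ∩ (coverRun S η θ κ ω t).U).card : ℝ) ≤ 1 / (1 - η) ^ t + w := by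
  induction ht using Nat.decreasingInduction with
  | self =>
    intro a _
    have hcard : ((S a ∩ (coverRun S η θ κ ω T).U).card : ℝ) ≤ N :=
      Nat.cast_le.2 (card_finset_fin_le _)
    linarith
  | of_succ t ht ih =>
    rw [coverRun_eq_phase _ _ _ _ _ ht]
    exact card_inter_phase_U_le_pow hη hη' (hω.tame _) hθ hw hzw hκ ih (hω.exhausted ⟨t, ht⟩)

lemma forallPrefix_nearGreedy_coverRun (hη : 0 ≤ η) (hη' : η ≤ 1 / 5)
    (hω : GoodDraws S η θ κ ω z) (hθ : θ ≤ z) (hz : 0 ≤ z) (hw : 0 ≤ w) (hzw : 3 * z ≤ η * w)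
    (hκ : w + z ≤ κ) (hT : N ≤ 1 / (1 - η) ^ T) (hv : w + κ + 3 * z ≤ v) {t : ℕ} (ht : t ≤ T) :
    ForallPrefix (NearGreedy S η v) (coverRun S η θ κ ω t).out := by
  induction ht using Nat.decreasingInduction with
  | self => exact coverRun_self S η θ κ ω ▸ forallPrefix_nil _
  | of_succ t ht ih =>
    rw [coverRun_eq_phase _ _ _ _ _ ht]
    exact forallPrefix_nearGreedy_phase (coverInvariant_coverRun ht) hη hη' (hω.tame _) hw
      (by linarith) hv (card_inter_coverRun_U_le hη (by linarith) hω hθ hw hzw hκ hT ht) ih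

lemma card_inter_coverRun_zero_U_le (hη : 0 < η) (hη' : η < 1 / 5) (hω : GoodDraws S η θ κ ω z)
    (hθ : θ ≤ z) (hw : 0 ≤ w) (hzw : 3 * z ≤ η * w) (hκ : w + z ≤ κ)
    (hT : N ≤ 1 / (1 - η) ^ T) (hT0 : 0 < T) :
    ∀ a ∈ (coverRun S η θ κ ω 0).rem, ((S a ∩ (coverRun S η θ κ ω 0).U).card : ℝ) ≤ 5 * w := by
  rw [coverRun_eq_phase _ _ _ _ _ hT0]
  exact card_inter_phase_zero_U_le hη hη' (hω.tame _) hθ hw hzw hκ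
    (card_inter_coverRun_U_le hη.le (by linarith) hω hθ hw hzw hκ hT hT0) (hω.exhausted ⟨0, hT0⟩)

lemma forallPrefix_nearGreedy_out_append (hη : 0 < η) (hη' : η < 1 / 5)
    (hω : GoodDraws S η θ κ ω z) (hθ : θ ≤ z) (hz : 0 ≤ z) (hw : 0 ≤ w) (hzw : 3 * z ≤ η * w)
    (hκ : w + z ≤ κ) (hT : N ≤ 1 / (1 - η) ^ T) (hT0 : 0 < T) (hv : w + κ + 3 * z ≤ v)
    (hv' : 5 * w ≤ v) (l : List (Fin m)) :
    ForallPrefix (NearGreedy S η v) ((coverRun S η θ κ ω 0).out ++ l) := by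
  refine (forallPrefix_nearGreedy_coverRun hη.le hη'.le hω hθ hz hw hzw hκ hT hv
    T.zero_le).append fun P a _ _ g => ?_
  have hgreedy := (coverInvariant_coverRun T.zero_le).newCoverage_append_le (by positivity)
    (card_inter_coverRun_zero_U_le hη hη' hω hθ hw hzw hκ hT hT0) P g
  nlinarith [Nat.cast_nonneg (α := ℝ) (newCoverage S ((coverRun S η θ κ ω 0).out ++ P) g),
    Nat.cast_nonneg (α := ℝ) (newCoverage S ((coverRun S η θ κ ω 0).out ++ P) a)]

lemma ForallPrefix.getElem {α : Type*} {Q : List α → α → Prop} {l : List α}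
    (h : ForallPrefix Q l) (i : ℕ) (hi : i < l.length) : Q (l.take i) l[i] :=
  h _ _ (l.drop (i + 1)) (by simp)

lemma ForallPrefix.isPrefixOptimal {l : List (Fin m)}
    (h : ForallPrefix (NearGreedy S η v) l) : IsPrefixOptimal S (1 - 5 * η) v l := by
  refine ⟨fun _ => 1 - 5 * η, fun i hi => ⟨?_, fun g _ => h.getElem i hi g⟩⟩
  rw [Finset.sum_const, Finset.card_range, nsmul_eq_mul, le_div_iff₀ (by positivity)]
  push_cast
  linarith

end Run

/-! ### Probability of untame draws -/

section UntameDraws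

variable {m R : ℕ} {β₀ β₁ β z u : ℝ}

lemma laplace_setOf_lt_abs_le_exp_neg (hβ : 0 < β) (hu : 0 ≤ u) (huz : u * β ≤ z) :
    laplace β {x | z < |x|} ≤ ENNReal.ofReal (Real.exp (-u)) :=
  calc laplace β {x | z < |x|} ≤ laplace β {x | u * β < |x|} :=
        measure_mono fun _ hx => huz.trans_lt hx
    _ ≤ ENNReal.ofReal (Real.exp (-(u * β) / β)) := laplace_setOf_lt_abs_le hβ (by positivity)
    _ = ENNReal.ofReal (Real.exp (-u)) := by rw [← neg_mul, mul_div_cancel_right₀ _ hβ.ne']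

lemma measure_pi_laplace_setOf_exists_lt_abs_le (hβ : 0 < β) (hu : 0 ≤ u) (huz : u * β ≤ z) :
    Measure.pi (fun _ : Fin m => laplace β) {ν | ∃ a, ν a ∈ {x | z < |x|}} ≤
      m * ENNReal.ofReal (Real.exp (-u)) := by
  have := isProbabilityMeasure_laplace hβ
  simpa only [Fintype.card_fin] using measure_pi_setOf_exists_le (fun _ : Fin m => laplace β)
    fun _ => laplace_setOf_lt_abs_le_exp_neg hβ hu huz

lemma roundLaw_setOf_priority_eq_eq_zero (hβ : 0 < β) {a a' : Fin m} (hne : a ≠ a') :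
    roundLaw m β {ω | (ω a).1 = (ω a').1} = 0 := by
  have := isProbabilityMeasure_laplace hβ
  refine nonpos_iff_eq_zero.1 (measure_pi_le_of_forall_measure_le _ a (f := fun ω => (ω a').1)
    (E := {p : ℝ × ℝ × ℝ × ℝ | p.2.1 = p.1}) (measurable_pi_apply a').fst
    (fun ω y => by rw [Function.update_of_ne hne.symm])
    (measurableSet_eq_fun measurable_snd.fst measurable_fst) fun x => ?_)
  have hslice : {y : ℝ × ℝ × ℝ | (x, y) ∈ {p : ℝ × ℝ × ℝ × ℝ | p.2.1 = p.1}} =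
      {x} ×ˢ Set.univ := by
    ext y
    simp
  rw [hslice, Measure.prod_prod, measure_singleton, zero_mul]

lemma roundLaw_setOf_not_injective_eq_zero (hβ : 0 < β) :
    roundLaw m β {ω | ¬ Function.Injective fun a => (ω a).1} = 0 := by
  have hsub : {ω : RoundTape m | ¬ Function.Injective fun a => (ω a).1} ⊆
      ⋃ p : {p : Fin m × Fin m // p.1 ≠ p.2}, {ω | (ω p.1.1).1 = (ω p.1.2).1} := by
    intro ω hω
    obtain ⟨a, a', heq, hne⟩ := Function.not_injective_iff.1 hω
    exact Set.mem_iUnion.2 ⟨⟨(a, a'), hne⟩, heq⟩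
  exact measure_mono_null hsub (measure_iUnion_null fun p =>
    roundLaw_setOf_priority_eq_eq_zero hβ p.2)

lemma roundLaw_setOf_not_tameRound_le (hβ : 0 < β) (hu : 0 ≤ u) (huz : u * β ≤ z) :
    roundLaw m β {ω | ¬ TameRound z ω} ≤ m * (2 * ENNReal.ofReal (Real.exp (-u))) := by
  have := isProbabilityMeasure_laplace hβ
  let large : Set ℝ := {x | z < |x|}
  let loud : Set (ℝ × ℝ × ℝ) := {d | d.1 ∈ Set.univ ∧ d.2 ∈ {p : ℝ × ℝ | p.1 ∈ large ∨ p.2 ∈ large}}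
  have hsub : {ω : RoundTape m | ¬ TameRound z ω} ⊆
      {ω | ∃ a, ω a ∈ loud} ∪ {ω | ¬ Function.Injective fun a => (ω a).1} := by
    intro ω hω
    by_contra hcon
    obtain ⟨hquiet, hinj⟩ := not_or.1 hcon
    exact hω ⟨fun a => not_lt.1 fun h => hquiet ⟨a, trivial, Or.inl h⟩,
      fun a => not_lt.1 fun h => hquiet ⟨a, trivial, Or.inr h⟩, not_not.1 hinj⟩
  have hloud : uniform01.prod ((laplace β).prod (laplace β)) loud ≤
      2 * ENNReal.ofReal (Real.exp (-u)) :=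
    calc uniform01.prod ((laplace β).prod (laplace β)) loud
        = (laplace β).prod (laplace β) {p | p.1 ∈ large ∨ p.2 ∈ large} := by
          rw [show loud = Set.univ ×ˢ {p : ℝ × ℝ | p.1 ∈ large ∨ p.2 ∈ large} from rfl,
            Measure.prod_prod, measure_univ, one_mul]
      _ ≤ laplace β large + laplace β large := measure_prod_setOf_or_le _ _ _ _
      _ ≤ 2 * ENNReal.ofReal (Real.exp (-u)) := by
          rw [two_mul]
          exact add_le_add (laplace_setOf_lt_abs_le_exp_neg hβ hu huz)
            (laplace_setOf_lt_abs_le_exp_neg hβ hu huz)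
  calc roundLaw m β {ω | ¬ TameRound z ω}
      ≤ roundLaw m β {ω | ∃ a, ω a ∈ loud} +
          roundLaw m β {ω | ¬ Function.Injective fun a => (ω a).1} :=
        (measure_mono hsub).trans (measure_union_le _ _)
    _ ≤ m * (2 * ENNReal.ofReal (Real.exp (-u))) := by
        rw [roundLaw_setOf_not_injective_eq_zero hβ, add_zero]
        simpa only [Fintype.card_fin, roundLaw] using measure_pi_setOf_exists_le
          (fun _ : Fin m => uniform01.prod ((laplace β).prod (laplace β))) fun _ => hloud

/-- The law of the draws of one phase, when the noise has scale `β₀` in the bucket test, `β₁` in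
the degree estimates and `β` in the rounds. -/
noncomputable def phaseLaw (m R : ℕ) (β₀ β₁ β : ℝ) : Measure ((Fin m → ℝ) × ManisTape m R) :=
  (Measure.pi fun _ : Fin m => laplace β₀).prod
    ((Measure.pi fun _ : Fin m => laplace β₁).prod (Measure.pi fun _ : Fin R => roundLaw m β))

lemma isProbabilityMeasure_phaseLaw (hβ₀ : 0 < β₀) (hβ₁ : 0 < β₁) (hβ : 0 < β) :
    IsProbabilityMeasure (phaseLaw m R β₀ β₁ β) := by
  have := isProbabilityMeasure_laplace hβ₀
  have := isProbabilityMeasure_laplace hβ₁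
  have := isProbabilityMeasure_roundLaw m hβ
  unfold phaseLaw
  infer_instance

lemma phaseLaw_setOf_not_tamePhase_le (hβ₀ : 0 < β₀) (hβ₁ : 0 < β₁) (hβ : 0 < β) (hu : 0 ≤ u)
    (hz₀ : u * β₀ ≤ z) (hz₁ : u * β₁ ≤ z) (hz : u * β ≤ z) :
    phaseLaw m R β₀ β₁ β {ω | ¬ TamePhase z ω} ≤
      (m * (2 + 2 * R) : ℕ) * ENNReal.ofReal (Real.exp (-u)) := by
  have := isProbabilityMeasure_laplace hβ₀
  have := isProbabilityMeasure_laplace hβ₁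
  have := isProbabilityMeasure_roundLaw m hβ
  let loud : Set (Fin m → ℝ) := {ν | ∃ a, ν a ∈ {x | z < |x|}}
  let untame : Set (Fin R → RoundTape m) := {ω | ∃ r, ω r ∈ {ω | ¬ TameRound z ω}}
  have hsub : {ω : (Fin m → ℝ) × ManisTape m R | ¬ TamePhase z ω} ⊆
      {ω | ω.1 ∈ loud ∨ ω.2 ∈ {ω : ManisTape m R | ω.1 ∈ loud ∨ ω.2 ∈ untame}} := by
    intro ω hω
    by_contra hcon
    obtain ⟨hbucket, hcon⟩ := not_or.1 hcon
    obtain ⟨hdegree, hrounds⟩ := not_or.1 hcon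
    exact hω ⟨fun a => not_lt.1 fun h => hbucket ⟨a, h⟩, fun a => not_lt.1 fun h => hdegree ⟨a, h⟩,
      fun r => not_not.1 fun h => hrounds ⟨r, h⟩⟩
  have huntame : Measure.pi (fun _ : Fin R => roundLaw m β) untame ≤
      R * (m * (2 * ENNReal.ofReal (Real.exp (-u)))) := by
    simpa only [Fintype.card_fin] using measure_pi_setOf_exists_le (fun _ : Fin R => roundLaw m β)
      fun _ => roundLaw_setOf_not_tameRound_le hβ hu hz
  calc phaseLaw m R β₀ β₁ β {ω | ¬ TamePhase z ω}
      ≤ Measure.pi (fun _ : Fin m => laplace β₀) loud +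
          (Measure.pi (fun _ : Fin m => laplace β₁) loud +
            Measure.pi (fun _ : Fin R => roundLaw m β) untame) :=
        (measure_mono hsub).trans ((measure_prod_setOf_or_le _ _ _ _).trans
          (add_le_add le_rfl (measure_prod_setOf_or_le _ _ _ _)))
    _ ≤ m * ENNReal.ofReal (Real.exp (-u)) + (m * ENNReal.ofReal (Real.exp (-u)) +
          R * (m * (2 * ENNReal.ofReal (Real.exp (-u))))) := by
        gcongr
        · exact measure_pi_laplace_setOf_exists_lt_abs_le hβ₀ hu hz₀
        · exact measure_pi_laplace_setOf_exists_lt_abs_le hβ₁ hu hz₁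
    _ = (m * (2 + 2 * R) : ℕ) * ENNReal.ofReal (Real.exp (-u)) := by
        push_cast
        ring

end UntameDraws

/-! ### Probability of bad draws -/

section BadDraws

variable {m N R T : ℕ} (S : Fin m → Finset (Fin N)) (η θ κ : ℝ)

lemma measurable_bucket (t : ℕ) (s : CoverState m N) : Measurable (bucket S η κ t s) := by
  refine measurable_finset_filter measurable_const fun a => Measurable.and ?_ ?_
  · exact measurableSet_setOfPred.1
      (measurableSet_le measurable_const ((measurable_pi_apply a).const_add _))
  · exact measurableSet_setOfPred.1
      (measurableSet_le ((measurable_pi_apply a).const_add _) measurable_const)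

lemma measurable_phaseCall (t : ℕ) : Measurable fun p : CoverState m N ×
    ((Fin m → ℝ) × ManisTape m R) => phaseCall S η θ κ t p.2 p.1 := by
  refine measurable_from_prod_countable_right fun s => ?_
  have hstart : Measurable fun ω : (Fin m → ℝ) × ManisTape m R =>
      (⟨bucket S η κ t s ω.1, s.U, []⟩ : ManisState m N) :=
    (Measurable.of_discrete (f := fun A => (⟨A, s.U, []⟩ : ManisState m N))).comp
      ((measurable_bucket S η κ t s).comp measurable_fst)
  have hdeg : ∀ a, Measurable fun ω : (Fin m → ℝ) × ManisTape m R =>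
      ((S a ∩ s.U).card + ω.2.1 a : ℝ) :=
    fun a => ((measurable_pi_apply a).comp measurable_snd.fst).const_add _
  exact measurable_manisRun S η θ hdeg hstart measurable_snd.snd le_rfl

lemma measurable_phase (t : ℕ) : Measurable fun p : CoverState m N ×
    ((Fin m → ℝ) × ManisTape m R) => phase S η θ κ t p.2 p.1 := by
  have hupdate : Measurable fun p : CoverState m N × ManisState m N =>
      (⟨p.1.U \ p.2.out.toFinset.biUnion S, p.1.rem \ p.2.out.toFinset, p.1.out ++ p.2.out⟩ :
        CoverState m N) := Measurable.of_discrete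
  have hcomp := hupdate.comp (measurable_fst.prodMk (measurable_phaseCall (R := R) S η θ κ t))
  exact hcomp

lemma measurable_coverRun {t : ℕ} (ht : t ≤ T) :
    Measurable fun ω : CoverTape m T R => coverRun S η θ κ ω t := by
  induction ht using Nat.decreasingInduction with
  | self => simpa only [coverRun_self] using measurable_const
  | of_succ t ht ih =>
    simp only [coverRun_eq_phase _ _ _ _ _ ht]
    have hdraws : Measurable fun ω : CoverTape m T R => ω ⟨t, ht⟩ := measurable_pi_apply _
    have hcomp := (measurable_phase (R := R) S η θ κ t).comp (ih.prodMk hdraws)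
    exact hcomp

lemma coverRun_update (ω : CoverTape m T R) (i : Fin T) (y : (Fin m → ℝ) × ManisTape m R) {t : ℕ}
    (hit : i < t) (ht : t ≤ T) :
    coverRun S η θ κ (Function.update ω i y) t = coverRun S η θ κ ω t := by
  induction ht using Nat.decreasingInduction with
  | self => simp only [coverRun_self]
  | of_succ t ht ih =>
    have hne : (⟨t, ht⟩ : Fin T) ≠ i := (Fin.ne_of_lt hit).symm
    rw [coverRun_eq_phase _ _ _ _ _ ht, coverRun_eq_phase _ _ _ _ _ ht,
      ih (hit.trans t.lt_succ_self), Function.update_of_ne hne]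

lemma measurableSet_edges_phaseCall_nonempty (t : ℕ) :
    MeasurableSet {p : CoverState m N × ((Fin m → ℝ) × ManisTape m R) |
      (edges S (phaseCall S η θ κ t p.2 p.1)).Nonempty} :=
  measurable_phaseCall S η θ κ t
    (MeasurableSet.of_discrete (s := {s : ManisState m N | (edges S s).Nonempty}))

variable {S η θ κ} {β₀ β₁ β z u : ℝ}

lemma phaseLaw_setOf_edges_phaseCall_nonempty_le (hβ₀ : 0 < β₀) (hβ₁ : 0 < β₁) (hβ : 0 < β)
    (hη : 0 < η) (hη' : η ≤ 1 / 4) (hθ : 0 ≤ θ) (t : ℕ) (s : CoverState m N) :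
    phaseLaw m R β₀ β₁ β {ω | (edges S (phaseCall S η θ κ t ω s)).Nonempty} ≤
      ENNReal.ofReal (1 - decayRate η) ^ R * (m * N : ℕ) := by
  have := isProbabilityMeasure_laplace hβ₀
  have := isProbabilityMeasure_laplace hβ₁
  have := isProbabilityMeasure_roundLaw m hβ
  have hmeas : MeasurableSet {ω : (Fin m → ℝ) × ManisTape m R |
      (edges S (phaseCall S η θ κ t ω s)).Nonempty} :=
    measurable_prodMk_left (measurableSet_edges_phaseCall_nonempty S η θ κ t)
  have hmeas_snd (ν : Fin m → ℝ) : MeasurableSet {ω : ManisTape m R |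
      (edges S (phaseCall S η θ κ t (ν, ω) s)).Nonempty} :=
    measurable_prodMk_left hmeas
  have hrounds (ν ν' : Fin m → ℝ) : (Measure.pi fun _ : Fin R => roundLaw m β)
      {ω | (edges S (phaseCall S η θ κ t (ν, ν', ω) s)).Nonempty} ≤
        ENNReal.ofReal (1 - decayRate η) ^ R * (m * N : ℕ) := by
    have hle := measure_edges_manisRun_nonempty_le (R := R) (S := S)
      (deg := fun a => ((S a ∩ s.U).card : ℝ) + ν' a) (s := ⟨bucket S η κ t s ν, s.U, []⟩)
      hβ hη hη' hθ
    simp only [phaseCall]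
    exact hle
  exact measure_prod_le_of_forall_measure_le _ _ hmeas fun ν =>
    measure_prod_le_of_forall_measure_le _ _ (hmeas_snd ν) (hrounds ν)

lemma measure_pi_phaseLaw_setOf_edges_nonempty_le (hβ₀ : 0 < β₀) (hβ₁ : 0 < β₁) (hβ : 0 < β)
    (hη : 0 < η) (hη' : η ≤ 1 / 4) (hθ : 0 ≤ θ) (i : Fin T) :
    Measure.pi (fun _ : Fin T => phaseLaw m R β₀ β₁ β)
      {ω | (edges S (phaseCall S η θ κ i (ω i) (coverRun S η θ κ ω (i + 1)))).Nonempty} ≤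
      ENNReal.ofReal (1 - decayRate η) ^ R * (m * N : ℕ) := by
  have := isProbabilityMeasure_phaseLaw (m := m) (R := R) hβ₀ hβ₁ hβ
  exact measure_pi_le_of_forall_measure_le (fun _ : Fin T => phaseLaw m R β₀ β₁ β) i
    (measurable_coverRun S η θ κ i.2)
    (fun ω y => coverRun_update S η θ κ ω i y (Nat.lt_succ_self _) i.2)
    (measurableSet_edges_phaseCall_nonempty S η θ κ i)
    fun s => phaseLaw_setOf_edges_phaseCall_nonempty_le hβ₀ hβ₁ hβ hη hη' hθ i s

lemma measure_setOf_not_goodDraws_le (hβ₀ : 0 < β₀) (hβ₁ : 0 < β₁) (hβ : 0 < β)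
    (hη : 0 < η) (hη' : η ≤ 1 / 4) (hθ : 0 ≤ θ) (hu : 0 ≤ u)
    (hz₀ : u * β₀ ≤ z) (hz₁ : u * β₁ ≤ z) (hz : u * β ≤ z) :
    Measure.pi (fun _ : Fin T => phaseLaw m R β₀ β₁ β) {ω | ¬ GoodDraws S η θ κ ω z} ≤
      T * ((m * (2 + 2 * R) : ℕ) * ENNReal.ofReal (Real.exp (-u))) +
      T * (ENNReal.ofReal (1 - decayRate η) ^ R * (m * N : ℕ)) := by
  have := isProbabilityMeasure_phaseLaw (m := m) (R := R) hβ₀ hβ₁ hβ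
  let untame : Set (CoverTape m T R) := {ω | ∃ i, ω i ∈ {ω | ¬ TamePhase z ω}}
  let unfinished (i : Fin T) : Set (CoverTape m T R) :=
    {ω | (edges S (phaseCall S η θ κ i (ω i) (coverRun S η θ κ ω (i + 1)))).Nonempty}
  have hsub : {ω : CoverTape m T R | ¬ GoodDraws S η θ κ ω z} ⊆ untame ∪ ⋃ i, unfinished i := by
    intro ω hω
    by_contra hcon
    obtain ⟨htame, hfinished⟩ := not_or.1 hcon
    exact hω ⟨fun i => not_not.1 fun h => htame ⟨i, h⟩, fun i =>
      Finset.not_nonempty_iff_eq_empty.1 fun h => hfinished (Set.mem_iUnion.2 ⟨i, h⟩)⟩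
  refine (measure_mono hsub).trans ((measure_union_le _ _).trans (add_le_add ?_ ?_))
  · simpa only [Fintype.card_fin] using
      measure_pi_setOf_exists_le (fun _ : Fin T => phaseLaw m R β₀ β₁ β)
        fun _ => phaseLaw_setOf_not_tamePhase_le hβ₀ hβ₁ hβ hu hz₀ hz₁ hz
  · calc Measure.pi (fun _ : Fin T => phaseLaw m R β₀ β₁ β) (⋃ i, unfinished i)
        ≤ ∑ i, Measure.pi (fun _ : Fin T => phaseLaw m R β₀ β₁ β) (unfinished i) :=
          measure_iUnion_fintype_le _ _
      _ ≤ ∑ _i : Fin T, ENNReal.ofReal (1 - decayRate η) ^ R * (m * N : ℕ) :=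
          Finset.sum_le_sum fun i _ =>
            measure_pi_phaseLaw_setOf_edges_nonempty_le hβ₀ hβ₁ hβ hη hη' hθ i
      _ = T * (ENNReal.ofReal (1 - decayRate η) ^ R * (m * N : ℕ)) := by simp

end BadDraws

/-! ### Choice of the constants -/

section Constants

variable {n k m N R T : ℕ} {η C₁ C₂ K ε : ℝ}

lemma half_lt_log (hn : 2 ≤ n) : 1 / 2 < Real.log n :=
  calc (1 / 2 : ℝ) < Real.log 2 := by linarith [Real.log_two_gt_d9]
    _ ≤ Real.log n := Real.log_le_log two_pos (Nat.ofNat_le_cast.2 hn)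

lemma one_lt_one_div_one_sub (hη : 0 < η) (hη' : η < 1) : 1 < 1 / (1 - η) :=
  one_lt_one_div (sub_pos.2 hη') (sub_lt_self 1 hη)

lemma phases_pos (hn : 2 ≤ n) (hη : 0 < η) (hη' : η < 1) : 0 < phases n η :=
  Nat.ceil_pos.2 (Real.logb_pos (one_lt_one_div_one_sub hη hη') (Nat.one_lt_cast.2 hn))

lemma le_one_div_pow_phases (hn : 0 < n) (hη : 0 < η) (hη' : η < 1) :
    n ≤ 1 / (1 - η) ^ phases n η := by
  have hceil : Real.logb (1 / (1 - η)) n ≤ phases n η := Nat.le_ceil _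
  rwa [Real.logb_le_iff_le_rpow (one_lt_one_div_one_sub hη hη') (Nat.cast_pos.2 hn),
    Real.rpow_natCast, one_div_pow] at hceil

/-- The number of phases is at most this factor times `log n`. -/
noncomputable def phaseFactor (η : ℝ) : ℝ := 1 / Real.log (1 / (1 - η)) + 2

lemma phaseFactor_pos (hη : 0 < η) (hη' : η < 1) : 0 < phaseFactor η :=
  add_pos (one_div_pos.2 (Real.log_pos (one_lt_one_div_one_sub hη hη'))) two_pos

lemma phases_le (hn : 2 ≤ n) (hη : 0 < η) (hη' : η < 1) :
    phases n η ≤ phaseFactor η * Real.log n := by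
  have hlogb := Real.logb_pos (one_lt_one_div_one_sub hη hη') (Nat.one_lt_cast.2 hn)
  calc (phases n η : ℝ) ≤ Real.logb (1 / (1 - η)) n + 1 := (Nat.ceil_lt_add_one hlogb.le).le
    _ = 1 / Real.log (1 / (1 - η)) * Real.log n + 1 := by
      rw [Real.logb, div_mul_eq_mul_div, one_mul]
    _ ≤ phaseFactor η * Real.log n := by
      rw [phaseFactor]
      linarith [half_lt_log hn]

lemma eps0_pos (hn : 2 ≤ n) (hη : 0 < η) (hη' : η < 1) (hε : 0 < ε) : 0 < eps0 n η ε :=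
  div_pos hε (mul_pos two_pos (Nat.cast_pos.2 (phases_pos hn hη hη')))

lemma manisEps_pos (hn : 2 ≤ n) (hC₁ : 0 < C₁) (hε : 0 < ε) : 0 < manisEps n C₁ ε :=
  div_pos hε (mul_pos hC₁ (by linarith [half_lt_log hn]))

lemma isProbabilityMeasure_coverLaw (hn : 2 ≤ n) (hη : 0 < η) (hη' : η < 1) (hC₁ : 0 < C₁)
    (hε : 0 < ε) : IsProbabilityMeasure (coverLaw m n η C₁ C₂ ε) := by
  have hε₀ := eps0_pos hn hη hη' hε
  have hδ := manisEps_pos hn hC₁ hε₀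
  have := isProbabilityMeasure_phaseLaw (m := m) (R := manisRounds n C₂) (one_div_pos.2 hε₀)
    (div_pos two_pos hδ) (one_div_pos.2 hδ)
  exact inferInstanceAs (IsProbabilityMeasure (Measure.pi fun _ : Fin (phases n η) =>
    phaseLaw m (manisRounds n C₂) (1 / eps0 n η ε) (2 / manisEps n C₁ (eps0 n η ε))
      (1 / manisEps n C₁ (eps0 n η ε))))

lemma exp_neg_natCast_mul_log (hn : 0 < n) (j : ℕ) :
    Real.exp (-(j * Real.log n)) = 1 / (n : ℝ) ^ j := by
  rw [Real.exp_neg, Real.exp_nat_mul, Real.exp_log (Nat.cast_pos.2 hn), one_div]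

lemma one_sub_pow_manisRounds_le (hn : 0 < n) {q : ℝ} (hq : 0 < q) (hq' : q ≤ 1) {j : ℕ}
    (hC₂ : j / q ≤ C₂) : (1 - q) ^ manisRounds n C₂ ≤ 1 / (n : ℝ) ^ j := by
  have : 0 ≤ Real.log n := Real.log_natCast_nonneg n
  have hrounds : C₂ * Real.log n ≤ manisRounds n C₂ :=
    (Nat.le_ceil _).trans (Nat.cast_le.2 (Nat.le_succ _))
  calc (1 - q) ^ manisRounds n C₂ ≤ Real.exp (-q) ^ manisRounds n C₂ :=
        pow_le_pow_left₀ (sub_nonneg.2 hq') (Real.one_sub_le_exp_neg q) _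
    _ = Real.exp (-(manisRounds n C₂ * q)) := by rw [← Real.exp_nat_mul, mul_neg]
    _ ≤ Real.exp (-(j * Real.log n)) := by
        refine Real.exp_le_exp.2 (neg_le_neg ?_)
        calc j * Real.log n ≤ C₂ * q * Real.log n := by
              gcongr
              exact (div_le_iff₀ hq).1 hC₂
          _ = C₂ * Real.log n * q := by ring
          _ ≤ manisRounds n C₂ * q := by gcongr
    _ = 1 / (n : ℝ) ^ j := exp_neg_natCast_mul_log hn j

lemma manisRounds_le (hn : 2 ≤ n) (hC₂ : 0 ≤ C₂) :
    manisRounds n C₂ ≤ (C₂ + 4) * Real.log n := by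
  have hlog := half_lt_log hn
  calc (manisRounds n C₂ : ℝ) = ⌈C₂ * Real.log n⌉₊ + 1 := Nat.cast_succ _
    _ ≤ C₂ * Real.log n + 1 + 1 := by
        gcongr
        exact (Nat.ceil_lt_add_one (by positivity)).le
    _ ≤ (C₂ + 4) * Real.log n := by linarith

lemma union_bound_le (hn : 2 ≤ n) (hN : N ≤ n) (hm : m ≤ n ^ k) {q a b : ℝ}
    (ha : 0 ≤ a) (hR : (1 - q) ^ R ≤ 1 / (n : ℝ) ^ (k + 3)) (hTa : T ≤ a * Real.log n)
    (hRb : R ≤ b * Real.log n) :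
    T * (m * (2 + 2 * R) * (1 / (n : ℝ) ^ (k + 2))) + T * ((1 - q) ^ R * (m * N)) ≤
      a * (6 + 2 * b) * Real.log n ^ 2 / (n : ℝ) ^ 2 := by
  have hlog := half_lt_log hn
  have : (0 : ℝ) < n := by positivity
  have hm' : (m : ℝ) ≤ (n : ℝ) ^ k := by exact_mod_cast hm
  have huntame : m * (2 + 2 * R) * (1 / (n : ℝ) ^ (k + 2)) ≤ (2 + 2 * R) / (n : ℝ) ^ 2 :=
    calc m * (2 + 2 * R) * (1 / (n : ℝ) ^ (k + 2))
        ≤ (n : ℝ) ^ k * (2 + 2 * R) * (1 / (n : ℝ) ^ (k + 2)) := by gcongr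
      _ = (2 + 2 * R) / (n : ℝ) ^ 2 := by rw [pow_add]; field_simp
  have hunfinished : (1 - q) ^ R * (m * N) ≤ 1 / (n : ℝ) ^ 2 :=
    calc (1 - q) ^ R * (m * N) ≤ 1 / (n : ℝ) ^ (k + 3) * ((n : ℝ) ^ k * n) := by gcongr
      _ = 1 / (n : ℝ) ^ 2 := by rw [pow_add]; field_simp
  calc T * (m * (2 + 2 * R) * (1 / (n : ℝ) ^ (k + 2))) + T * ((1 - q) ^ R * (m * N))
      ≤ T * ((2 + 2 * R) / (n : ℝ) ^ 2) + T * (1 / (n : ℝ) ^ 2) := by gcongr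
    _ = T * (3 + 2 * R) / (n : ℝ) ^ 2 := by ring
    _ ≤ (a * Real.log n) * ((6 + 2 * b) * Real.log n) / (n : ℝ) ^ 2 := by
        gcongr
        linarith
    _ = a * (6 + 2 * b) * Real.log n ^ 2 / (n : ℝ) ^ 2 := by ring

/-- In units of `log² n / ε₀`: a bound on the size of all noise, and on the offset of the survival
tests. -/
noncomputable def noiseFactor (k : ℕ) (C₁ : ℝ) : ℝ := 2 * (k + 2) * (1 + C₁) + 15 * C₁

/-- In units of `log² n / ε₀`: the excess of the coverage of a remaining set over its target
`(1 - η)⁻ᵗ`. -/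
noncomputable def excessFactor (η : ℝ) (k : ℕ) (C₁ : ℝ) : ℝ := 3 * noiseFactor k C₁ / η

/-- In units of `log² n / ε₀`: the additive loss against the greedy choice. -/
noncomputable def lossFactor (η : ℝ) (k : ℕ) (C₁ K : ℝ) : ℝ :=
  5 * excessFactor η k C₁ + K + 3 * noiseFactor k C₁

/-- The failure probability is at most this factor times `log² n / n²`. -/
noncomputable def failureFactor (η C₂ : ℝ) : ℝ :=
  phaseFactor η * (6 + 2 * (C₂ + 4))

lemma noiseFactor_pos (hC₁ : 0 < C₁) : 0 < noiseFactor k C₁ := by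
  unfold noiseFactor
  positivity

lemma excessFactor_pos (hη : 0 < η) (hC₁ : 0 < C₁) : 0 < excessFactor η k C₁ :=
  div_pos (mul_pos three_pos (noiseFactor_pos hC₁)) hη

lemma lossFactor_pos (hη : 0 < η) (hC₁ : 0 < C₁) (hK : 0 ≤ K) : 0 < lossFactor η k C₁ K := by
  have := noiseFactor_pos (k := k) hC₁
  have := excessFactor_pos (k := k) hη hC₁
  unfold lossFactor
  positivity

lemma failureFactor_pos (hη : 0 < η) (hη' : η < 1) (hC₂ : 0 ≤ C₂) : 0 < failureFactor η C₂ := by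
  have := phaseFactor_pos hη hη'
  unfold failureFactor
  positivity

lemma survivalOffset_eq : survivalOffset n η C₁ ε =
    6 * C₁ / (1 - 3 * η) * (Real.log n ^ 2 / eps0 n η ε) := by
  rw [survivalOffset, manisEps]
  field_simp

lemma survivalOffset_nonneg (hη : η ≤ 1 / 5) (hC₁ : 0 ≤ C₁) (hε₀ : 0 ≤ eps0 n η ε) :
    0 ≤ survivalOffset n η C₁ ε := by
  have : 0 ≤ 1 - 3 * η := by linarith
  rw [survivalOffset_eq]
  positivity

lemma survivalOffset_le (hη : η ≤ 1 / 5) (hC₁ : 0 ≤ C₁) (hε₀ : 0 ≤ eps0 n η ε) :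
    survivalOffset n η C₁ ε ≤ noiseFactor k C₁ * (Real.log n ^ 2 / eps0 n η ε) := by
  rw [survivalOffset_eq]
  gcongr
  calc 6 * C₁ / (1 - 3 * η) ≤ 15 * C₁ := by
        rw [div_le_iff₀ (by linarith)]
        nlinarith
    _ ≤ noiseFactor k C₁ := le_add_of_nonneg_left (by positivity)

lemma mul_one_div_eps0_le (hn : 2 ≤ n) (hC₁ : 0 ≤ C₁) (hε₀ : 0 < eps0 n η ε) :
    (k + 2 : ℕ) * Real.log n * (1 / eps0 n η ε) ≤
      noiseFactor k C₁ * (Real.log n ^ 2 / eps0 n η ε) := by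
  have hlog := half_lt_log hn
  calc (k + 2 : ℕ) * Real.log n * (1 / eps0 n η ε)
      = (k + 2 : ℕ) * Real.log n / eps0 n η ε := mul_one_div _ _
    _ ≤ 2 * (k + 2) * Real.log n ^ 2 / eps0 n η ε := by
        refine div_le_div_of_nonneg_right ?_ hε₀.le
        push_cast
        nlinarith [mul_nonneg (Nat.cast_nonneg (α := ℝ) k) (by linarith : 0 ≤ 2 * Real.log n - 1)]
    _ = 2 * (k + 2) * (Real.log n ^ 2 / eps0 n η ε) := mul_div_assoc _ _ _
    _ ≤ noiseFactor k C₁ * (Real.log n ^ 2 / eps0 n η ε) := by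
        gcongr
        unfold noiseFactor
        nlinarith [mul_nonneg (Nat.cast_nonneg (α := ℝ) k) hC₁]

lemma mul_two_div_manisEps_le (hC₁ : 0 ≤ C₁) (hε₀ : 0 ≤ eps0 n η ε) :
    (k + 2 : ℕ) * Real.log n * (2 / manisEps n C₁ (eps0 n η ε)) ≤
      noiseFactor k C₁ * (Real.log n ^ 2 / eps0 n η ε) :=
  calc (k + 2 : ℕ) * Real.log n * (2 / manisEps n C₁ (eps0 n η ε))
      = 2 * (k + 2) * C₁ * (Real.log n ^ 2 / eps0 n η ε) := by
        rw [manisEps, div_div_eq_mul_div]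
        push_cast
        ring
    _ ≤ noiseFactor k C₁ * (Real.log n ^ 2 / eps0 n η ε) := by
        gcongr
        unfold noiseFactor
        nlinarith [Nat.cast_nonneg (α := ℝ) k]

end Constants

/-! ### The algorithm with high probability -/

section HighProbability

variable {n k m N T R : ℕ} {S : Fin m → Finset (Fin N)} {η κ C₁ C₂ K ε v : ℝ}

lemma coverLaw_setOf_not_goodDraws_le (hn : 2 ≤ n) (hη : 0 < η) (hη' : η ≤ 1 / 5)
    (hC₂ : (k + 3 : ℕ) / decayRate η ≤ C₂) (hC₁ : 0 < C₁) (hε : 0 < ε) (hN : N ≤ n)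
    (hm : m ≤ n ^ k) :
    coverLaw m n η C₁ C₂ ε {ω | ¬ GoodDraws S η (survivalOffset n η C₁ ε) κ ω
      (noiseFactor k C₁ * (Real.log n ^ 2 / eps0 n η ε))} ≤
      ENNReal.ofReal (failureFactor η C₂ * Real.log n ^ 2 / (n : ℝ) ^ 2) := by
  have hn0 : 0 < n := two_pos.trans_le hn
  have hη1 : η < 1 := by linarith
  have hη4 : η ≤ 1 / 4 := by linarith
  have hlog : 0 < Real.log n := by linarith [half_lt_log hn]
  have hε₀ := eps0_pos hn hη hη1 hε
  have hδ := manisEps_pos hn hC₁ hε₀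
  have hC₂0 : 0 ≤ C₂ :=
    (div_nonneg (Nat.cast_nonneg _) (decayRate_pos hη hη4).le).trans hC₂
  have hq : 0 ≤ 1 - decayRate η := sub_nonneg.2 (decayRate_lt_one hη.le hη4).le
  have hdegree := mul_two_div_manisEps_le (n := n) (k := k) hC₁.le hε₀.le
  have hround : (k + 2 : ℕ) * Real.log n * (1 / manisEps n C₁ (eps0 n η ε)) ≤
      noiseFactor k C₁ * (Real.log n ^ 2 / eps0 n η ε) := by
    refine le_trans ?_ hdegree
    gcongr
    exact one_le_two
  refine (measure_setOf_not_goodDraws_le (one_div_pos.2 hε₀) (div_pos two_pos hδ)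
    (one_div_pos.2 hδ) hη hη4 (survivalOffset_nonneg hη' hC₁.le hε₀.le)
    (by positivity) (mul_one_div_eps0_le hn hC₁.le hε₀) hdegree hround).trans ?_
  have hbound := union_bound_le hn hN hm (phaseFactor_pos hη hη1).le
    (one_sub_pow_manisRounds_le hn0 (decayRate_pos hη hη4) (decayRate_lt_one hη.le hη4).le hC₂)
    (phases_le hn hη hη1) (manisRounds_le hn hC₂0)
  rw [exp_neg_natCast_mul_log hn0, ← ENNReal.ofReal_pow hq, ← ENNReal.ofReal_natCast,
    ← ENNReal.ofReal_natCast, ← ENNReal.ofReal_natCast, ← ENNReal.ofReal_mul (by positivity),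
    ← ENNReal.ofReal_mul (by positivity), ← ENNReal.ofReal_mul (by positivity),
    ← ENNReal.ofReal_mul (by positivity), ← ENNReal.ofReal_add (by positivity) (by positivity)]
  refine ENNReal.ofReal_le_ofReal ?_
  push_cast
  exact hbound

lemma forallPrefix_nearGreedy_coverOutput (hn : 2 ≤ n) (hη : 0 < η) (hη' : η < 1 / 5)
    (hC₁ : 0 < C₁) (hε : 0 < ε) (hN : N ≤ n) (hK : excessFactor η k C₁ + noiseFactor k C₁ ≤ K)
    {ω : CoverTape m (phases n η) R}
    (hω : GoodDraws S η (survivalOffset n η C₁ ε) (bucketSlack n η K ε) ω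
      (noiseFactor k C₁ * (Real.log n ^ 2 / eps0 n η ε))) :
    ForallPrefix (NearGreedy S η (lossFactor η k C₁ K * Real.log n ^ 2 / eps0 n η ε))
      (coverOutput S n η C₁ K ε ω) := by
  have hη1 : η < 1 := by linarith
  have hε₀ := eps0_pos hn hη hη1 hε
  have hz := noiseFactor_pos (k := k) hC₁
  have hw := excessFactor_pos (k := k) hη hC₁
  have hT : (N : ℝ) ≤ 1 / (1 - η) ^ phases n η :=
    (Nat.cast_le.2 hN).trans (le_one_div_pow_phases (two_pos.trans_le hn) hη hη1)
  have hzw : 3 * noiseFactor k C₁ = η * excessFactor η k C₁ :=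
    (mul_div_cancel₀ _ hη.ne').symm
  have hθ := survivalOffset_le (k := k) hη'.le hC₁.le hε₀.le
  rw [coverOutput_eq]
  simp only [bucketSlack, mul_div_assoc] at hω ⊢
  set L := Real.log n ^ 2 / eps0 n η ε
  have hL : 0 ≤ L := by positivity
  refine forallPrefix_nearGreedy_out_append (w := excessFactor η k C₁ * L) hη hη' hω hθ
    (by positivity) (by positivity) ?_ ?_ hT (phases_pos hn hη hη1) ?_ ?_ _
  · rw [← mul_assoc, ← mul_assoc, hzw]
  · rw [← add_mul]
    gcongr
  · rw [lossFactor]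
    nlinarith
  · rw [lossFactor]
    nlinarith

lemma one_sub_le_coverLaw_setOf_forallPrefix (hn : 2 ≤ n) (hη : 0 < η) (hη' : η < 1 / 5)
    (hC₂ : (k + 3 : ℕ) / decayRate η ≤ C₂) (hC₁ : 0 < C₁)
    (hK : excessFactor η k C₁ + noiseFactor k C₁ ≤ K) (hε : 0 < ε) (hN : N ≤ n)
    (hm : m ≤ n ^ k) :
    1 - ENNReal.ofReal (failureFactor η C₂ * Real.log n ^ 2 / (n : ℝ) ^ 2) ≤
      coverLaw m n η C₁ C₂ ε {ω | ForallPrefix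
        (NearGreedy S η (lossFactor η k C₁ K * Real.log n ^ 2 / eps0 n η ε))
        (coverOutput S n η C₁ K ε ω)} := by
  have := isProbabilityMeasure_coverLaw (m := m) (C₂ := C₂) hn hη (by linarith) hC₁ hε
  let good : Set (CoverTape m (phases n η) (manisRounds n C₂)) :=
    {ω | GoodDraws S η (survivalOffset n η C₁ ε) (bucketSlack n η K ε) ω
      (noiseFactor k C₁ * (Real.log n ^ 2 / eps0 n η ε))}
  calc 1 - ENNReal.ofReal (failureFactor η C₂ * Real.log n ^ 2 / (n : ℝ) ^ 2)
      ≤ 1 - coverLaw m n η C₁ C₂ ε goodᶜ := tsub_le_tsub_left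
        (coverLaw_setOf_not_goodDraws_le hn hη hη'.le hC₂ hC₁ hε hN hm) 1
    _ ≤ coverLaw m n η C₁ C₂ ε good := tsub_le_iff_right.2
        (measure_univ (μ := coverLaw m n η C₁ C₂ ε) ▸ measure_univ_le_add_compl good)
    _ ≤ _ := measure_mono fun _ hω =>
        forallPrefix_nearGreedy_coverOutput hn hη hη' hC₁ hε hN hK hω

lemma forallPrefix_nearGreedy (hη : 1 / 5 ≤ η) (hv : 0 ≤ v) (l : List (Fin m)) :
    ForallPrefix (NearGreedy S η v) l := by
  intro P a _ _ g
  have hnonpos : (1 - 5 * η) * newCoverage S P g ≤ 0 :=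
    mul_nonpos_of_nonpos_of_nonneg (by linarith) (Nat.cast_nonneg _)
  have : (0 : ℝ) ≤ newCoverage S P a := Nat.cast_nonneg _
  linarith

end HighProbability

end DPCover

open DPCover in
theorem mainTheorem7 (η : ℝ) (hη₀ : 0 < η) (hη₁ : η < 1 / 3) (k : ℕ) :
    ∃ C₂min : ℝ, ∀ C₂ : ℝ, C₂min ≤ C₂ → ∀ C₁ : ℝ, 0 < C₁ →
    ∃ Kmin : ℝ, ∀ K : ℝ, Kmin ≤ K →
    ∃ (c C : ℝ) (d : ℕ), 0 < c ∧ 0 < C ∧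
    ∀ (n N m : ℕ), 2 ≤ n → N ≤ n → m ≤ n ^ k →
    ∀ (S : Fin m → Finset (Fin N)) (ε : ℝ), 0 < ε →
    1 - ENNReal.ofReal (C * Real.log n ^ d / (n : ℝ) ^ 2) ≤
      DPCover.coverLaw m n η C₁ C₂ ε
        {ω | (DPCover.coverOutput S n η C₁ K ε ω).Perm (List.finRange m) ∧
          DPCover.IsPrefixOptimal S (1 - 5 * η)
            (c * Real.log n ^ 2 / DPCover.eps0 n η ε) (DPCover.coverOutput S n η C₁ K ε ω) ∧
          ∀ (i : ℕ) (hi : i < (DPCover.coverOutput S n η C₁ K ε ω).length) (g : Fin m),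
            DPCover.IsGreedyChoice S ((DPCover.coverOutput S n η C₁ K ε ω).take i) g →
            (DPCover.newCoverage S ((DPCover.coverOutput S n η C₁ K ε ω).take i)
                (DPCover.coverOutput S n η C₁ K ε ω)[i] : ℝ) ≥
              (1 - 5 * η) *
                (DPCover.newCoverage S ((DPCover.coverOutput S n η C₁ K ε ω).take i) g : ℝ) -
              c * Real.log n ^ 2 / DPCover.eps0 n η ε} := by
  rcases lt_or_ge η (1 / 5) with hη | hη
  · refine ⟨(k + 3 : ℕ) / decayRate η, fun C₂ hC₂ C₁ hC₁ =>
      ⟨excessFactor η k C₁ + noiseFactor k C₁, fun K hK => ?_⟩⟩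
    have hK₀ : 0 ≤ K :=
      (add_pos (excessFactor_pos hη₀ hC₁) (noiseFactor_pos hC₁)).le.trans hK
    have hC₂₀ : 0 ≤ C₂ :=
      (div_nonneg (Nat.cast_nonneg _) (decayRate_pos hη₀ (by linarith)).le).trans hC₂
    refine ⟨lossFactor η k C₁ K, failureFactor η C₂, 2, lossFactor_pos hη₀ hC₁ hK₀,
      failureFactor_pos hη₀ (by linarith) hC₂₀, fun n N m hn hN hm S ε hε => ?_⟩
    exact (one_sub_le_coverLaw_setOf_forallPrefix hn hη₀ hη hC₂ hC₁ hK hε hN hm).trans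
      (measure_mono fun ω hω => ⟨coverOutput_perm n C₁ K ε, hω.isPrefixOptimal,
        fun i hi g _ => hω.getElem i hi g⟩)
  · refine ⟨0, fun C₂ _ C₁ hC₁ => ⟨0, fun K _ => ⟨1, 1, 0, one_pos, one_pos, ?_⟩⟩⟩
    intro n N m hn _ _ S ε hε
    have hη1 : η < 1 := by linarith
    have := isProbabilityMeasure_coverLaw (m := m) (C₂ := C₂) hn hη₀ hη1 hC₁ hε
    have hv : 0 ≤ 1 * Real.log n ^ 2 / eps0 n η ε :=
      div_nonneg (by positivity) (eps0_pos hn hη₀ hη1 hε).le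
    have hall := forallPrefix_nearGreedy (S := S) hη hv
    exact tsub_le_self.trans ((measure_univ (μ := coverLaw m n η C₁ C₂ ε)).ge.trans
      (measure_mono fun ω _ => ⟨coverOutput_perm n C₁ K ε, (hall _).isPrefixOptimal,
        fun i hi g _ => (hall _).getElem i hi g⟩))
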